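/- **Setting.** Let $X$ be a finite set of hypotheses, hypothesis $x\in X$ being described by a known vector $(x_1,\dots,x_D)\in\mathbb R^D$, let $P$ be a prior distribution on $X$, and let $U$ be a unitary on $\mathbb C^X$ with $U|x_0\rangle=\sum_x\sqrt{P(x)}\,|x\rangle$ for a fixed basis state $|x_0\rangle$. For each value $E$ of the observable the likelihood $P(E|x)\in[0,1]$ is stored, in a known fixed-length binary encoding, by the self-inverse oracle $O_E|x\rangle|y\rangle=|x\rangle|y\oplus P(E|x)\rangle$, and a constant $\Gamma_E$ with $P(E|x)\le\Gamma_E\le 1$ for all $x$ is known. Let $E_1,\dots,E_L$ be the observed values, put $$p=\Big\langle P(x),\prod_{k=1}^L \frac{P(E_k|x)}{\Gamma_{E_k}}\Big\rangle=\sum_x P(x)\prod_{k=1}^L\frac{P(E_k|x)}{\Gamma_{E_k}},$$ assume $p>0$, and let $P(x|E_1,\dots,E_L)\propto P(x)\prod_k P(E_k|x)$ be the posterior, with mean $\mu$, covariance matrix $\Sigma$ and second moments $\langle x_ix_j\rangle$. Suppose that numbers $\lambda_{0,i}$, $\lambda_{0,ij}$ (for instance the prior means of $x_i$ and $x_ix_j$)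 and $\Delta\lambda$ are known with $|x_i-\lambda_{0,i}|\le\Delta\lambda$ and $|x_ix_j-\lambda_{0,ij}|\le\Delta\lambda$ for all $x\in X$ and all $i,j$. Let $F(\cdot\,;\mu',\Sigma')$ be a family of probability models on $\mathbb R^D$ parameterized by a mean vector and a covariance matrix. **Theorem.** There are absolute constants $C>0$ and $c\in\mathbb N$ such that for all $\varepsilon>0$ and $\eta\in(0,1)$ there is an adaptive quantum algorithm, with black-box access to $U$, $U^{-1}$ and the oracles $O_E$, which knows the vectors $(x_1,\dots,x_D)$, the values $E_k$, $\Gamma_E$, $\lambda_0$, $\Delta\lambda$, $\varepsilon$, $\eta$ and the encoding, but not $P$, $p$ or the likelihoods, and which performs a semi-classical Bayesian update: with probability at least $1-\eta$ it halts after at most $$C\,T\,\log(2+T)^c\,\log(2/\eta),\qquad T=\frac{L D^2\,\Delta\lambda}{\varepsilon\,p},$$ queries to the oracles $O_E$ (that is, $\tilde O\big(LD^2\Delta\lambda/(\varepsilon p)\big)$ queries) and outputs a vector $\hat\mu\in\mathbb R^D$ and a positive semidefinite matrix $\hat\Sigma$ such that, for all $i,j$, $$|\hat\mu_i-\mu_i|\le\varepsilon,\qquad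 |(\hat\Sigma_{ij}+\hat\mu_i\hat\mu_j)-\langle x_ix_j\rangle|\le\varepsilon,\qquad |\hat\Sigma_{ij}-\Sigma_{ij}|\le R\,\varepsilon\ \text{ whenever } R\ge1 \text{ and } |x_l|\le R \text{ for all } x \text{ and } l.$$ In particular the covariance error is at most $\varepsilon$ when all $x\in[0,1]^D$. Consequently, if the model $F(\cdot\,;\hat\mu,\hat\Sigma)$ has mean $\hat\mu$ and covariance matrix $\hat\Sigma$, then its first and second moments agree with those of the posterior to within $\varepsilon$. -/

import Mathlib

open scoped BigOperators

noncomputable section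

namespace SemiClassicalBayes

/-! ### Bayesian inference over a finite set of hypotheses -/

/-- `P` is a probability distribution on the finite set `X`. -/
def IsDistribution {X : Type} [Fintype X] (P : X → ℝ) : Prop :=
  (∀ x, 0 ≤ P x) ∧ ∑ x, P x = 1

/-- The pairing `⟨f, g⟩ = ∑ x, f x * g x`. -/
def pairing {X : Type} [Fintype X] (f g : X → ℝ) : ℝ := ∑ x, f x * g x

/-- Bayes' rule `P(x|E) = P(E|x) P(x) / ⟨P(E|x), P(x)⟩` for a prior `P` and a likelihood `lik`. -/
def bayes {X : Type} [Fintype X] (P lik : X → ℝ) (x : X) : ℝ :=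
  lik x * P x / pairing lik P

/-- Posterior after the observations `E 0, …, E (L-1)`, with `lik e x = P(e|x)`; the joint
likelihood of the observations is the product of their likelihoods. -/
def posterior {X 𝓔 : Type} [Fintype X] {L : ℕ} (P : X → ℝ) (lik : 𝓔 → X → ℝ)
    (E : Fin L → 𝓔) : X → ℝ :=
  bayes P (fun x => ∏ k, lik (E k) x)

/-- The number `⟨P(x), ∏ₖ P(Eₖ|x) / Γ_{Eₖ}⟩`. -/
def overlap {X 𝓔 : Type} [Fintype X] {L : ℕ} (P : X → ℝ) (lik : 𝓔 → X → ℝ) (Γ : 𝓔 → ℝ)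
    (E : Fin L → 𝓔) : ℝ :=
  pairing P (fun x => ∏ k, lik (E k) x / Γ (E k))

/-- The likelihood `P(e|x)` stored in the bit string `bits e x`. -/
def likelihood {X 𝓔 : Type} {m : ℕ} (decode : (Fin m → Bool) → ℝ)
    (bits : 𝓔 → X → Fin m → Bool) (e : 𝓔) (x : X) : ℝ :=
  decode (bits e x)

/-- Mean of the vector `v x ∈ ℝ^D` when `x` is distributed according to `Q`. -/
def mean {X : Type} [Fintype X] {D : ℕ} (v : X → Fin D → ℝ) (Q : X → ℝ) (i : Fin D) : ℝ :=
  ∑ x, Q x * v x i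

/-- Second moments of the vector `v x ∈ ℝ^D` when `x` is distributed according to `Q`. -/
def secondMoment {X : Type} [Fintype X] {D : ℕ} (v : X → Fin D → ℝ) (Q : X → ℝ)
    (i j : Fin D) : ℝ :=
  ∑ x, Q x * (v x i * v x j)

/-- Covariance matrix of the vector `v x ∈ ℝ^D` when `x` is distributed according to `Q`. -/
def covMatrix {X : Type} [Fintype X] {D : ℕ} (v : X → Fin D → ℝ) (Q : X → ℝ) :
    Matrix (Fin D) (Fin D) ℝ :=
  Matrix.of fun i j => ∑ x, Q x * ((v x i - mean v Q i) * (v x j - mean v Q j))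

/-- `ν` is a probability distribution on `ℝ^D` with mean vector `μ` and covariance matrix `S`. -/
def HasMeanCov {D : ℕ} (ν : MeasureTheory.Measure (Fin D → ℝ)) (μ : Fin D → ℝ)
    (S : Matrix (Fin D) (Fin D) ℝ) : Prop :=
  MeasureTheory.IsProbabilityMeasure ν ∧
  (∀ i, MeasureTheory.MemLp (fun y : Fin D → ℝ => y i) 2 ν) ∧
  (∀ i, ∫ y, y i ∂ν = μ i) ∧
  ∀ i j, ProbabilityTheory.covariance (fun y : Fin D → ℝ => y i) (fun y => y j) ν = S i j

/-- The parameters `ρ = (μ, S)` are the result of a semi-classical update with error `ε`, for the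
posterior `Q` and the model family `F(·; μ, S)`: `S` is a legitimate covariance matrix, `μ` and `S`
give the first two moments of `Q` up to `ε` and the covariance matrix of `Q` up to `R * ε`, where
`R ≥ 1` bounds all coordinates (so up to `ε` if the hypotheses lie in the unit cube); and
the model `F(·; μ, S)`, if `μ` and `S` are its mean and covariance, captures the first two
moments of `Q` up to `ε`. -/
def IsSemiClassicalModel {X : Type} [Fintype X] {D : ℕ}
    (F : (Fin D → ℝ) → Matrix (Fin D) (Fin D) ℝ → MeasureTheory.Measure (Fin D → ℝ))
    (v : X → Fin D → ℝ) (Q : X → ℝ) (ε : ℝ)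
    (ρ : (Fin D → ℝ) × Matrix (Fin D) (Fin D) ℝ) : Prop :=
  ρ.2.PosSemidef ∧
  (∀ i, |ρ.1 i - mean v Q i| ≤ ε) ∧
  (∀ i j, |(ρ.2 i j + ρ.1 i * ρ.1 j) - secondMoment v Q i j| ≤ ε) ∧
  (∀ R : ℝ, 1 ≤ R → (∀ x i, |v x i| ≤ R) → ∀ i j, |ρ.2 i j - covMatrix v Q i j| ≤ R * ε) ∧
  (HasMeanCov (F ρ.1 ρ.2) ρ.1 ρ.2 →
    (∀ i, |(∫ y, y i ∂(F ρ.1 ρ.2)) - mean v Q i| ≤ ε) ∧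
    ∀ i j, |(∫ y, y i * y j ∂(F ρ.1 ρ.2)) - secondMoment v Q i j| ≤ ε)

/-! ### Quantum query algorithms with classical control -/

/-- Bit strings of length `m`. -/
abbrev Bits (m : ℕ) : Type := Fin m → Bool

/-- Computational basis labels: hypothesis register, likelihood register, workspace. -/
abbrev Config (X : Type) (m : ℕ) (W : Type) : Type := X × Bits m × W

/-- (Unnormalised) pure states of the three registers, as amplitude vectors. -/
abbrev Ket (X : Type) (m : ℕ) (W : Type) : Type := Config X m W → ℂ

/-- Squared norm of a state. -/
def normSq {X : Type} [Fintype X] {m : ℕ} {W : Type} [Fintype W] (ψ : Ket X m W) : ℝ :=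
  ∑ z, ‖ψ z‖ ^ 2

/-- Computational basis state. -/
def basisKet {X : Type} [DecidableEq X] {m : ℕ} {W : Type} [DecidableEq W]
    (z : Config X m W) : Ket X m W :=
  Pi.single z 1

/-- Apply a matrix on `ℂ^X` to the hypothesis register. -/
def applyHyp {X : Type} [Fintype X] {m : ℕ} {W : Type} (U : Matrix X X ℂ)
    (ψ : Ket X m W) : Ket X m W :=
  fun z => ∑ x', U z.1 x' * ψ (x', z.2)

/-- The oracle `|x⟩|y⟩ ↦ |x⟩|y ⊕ f x⟩` on the hypothesis and likelihood registers; the amplitude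
of the image at `(x, y)` is the amplitude of the original state at `(x, y ⊕ f x)`. -/
def applyOracle {X : Type} {m : ℕ} {W : Type} (f : X → Bits m) (ψ : Ket X m W) : Ket X m W :=
  fun z => ψ (z.1, (fun i => xor (z.2.1 i) (f z.1 i)), z.2.2)

/-- Project onto the basis states with measurement result `o` of the observable `c`. -/
def project {X : Type} {m : ℕ} {W : Type} {r : ℕ} (c : Config X m W → Fin r) (o : Fin r)
    (ψ : Ket X m W) : Ket X m W :=
  fun z => if c z = o then ψ z else 0

/-- One instruction of a classically controlled quantum algorithm. `S` is the set of classical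
control states, `𝓔` the set of observable values, and `Out` the set of outputs. -/
inductive Instr (X 𝓔 : Type) [Fintype X] [DecidableEq X] (m : ℕ)
    (W : Type) [Fintype W] [DecidableEq W] (S Out : Type) : Type where
  /-- stop with a classical output -/
  | halt (o : Out)
  /-- apply a fixed unitary, which involves no black box -/
  | gate (V : Matrix.unitaryGroup (Config X m W) ℂ) (next : S)
  /-- apply the unitary that prepares the prior state to the hypothesis register -/
  | prep (next : S)
  /-- apply the inverse of the preparation unitary -/
  | prepInv (next : S)
  /-- query the oracle `O_e` -/
  | query (e : 𝓔) (next : S)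
  /-- measure the observable `c`, diagonal in the computational basis, and branch -/
  | measure (r : ℕ) (c : Config X m W → Fin r) (next : Fin r → S)

/-- An adaptive quantum query algorithm: an initial basis state, an initial control state, and
the instruction to be carried out in each control state. -/
structure Algorithm (X 𝓔 : Type) [Fintype X] [DecidableEq X] (m : ℕ)
    (W : Type) [Fintype W] [DecidableEq W] (S Out : Type) where
  start : Config X m W
  init : S
  step : S → Instr X 𝓔 m W S Out

open Classical in
/-- For a run from control state `s` and (unnormalised) quantum state `ψ`, with preparation unitary
`U` and likelihood oracles `bits`: the probability that within `n` instructions, at most `q` of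
them oracle queries, the algorithm halts with an output that satisfies `good`. -/
def haltProb {X 𝓔 : Type} [Fintype X] [DecidableEq X] {m : ℕ}
    {W : Type} [Fintype W] [DecidableEq W] {S Out : Type}
    (A : Algorithm X 𝓔 m W S Out) (U : Matrix X X ℂ) (bits : 𝓔 → X → Bits m)
    (good : Out → Prop) : ℕ → ℕ → S → Ket X m W → ℝ
  | 0, _, _, _ => 0
  | n + 1, q, s, ψ =>
    match A.step s with
    | .halt o => if good o then normSq ψ else 0
    | .gate V s' => haltProb A U bits good n q s' (Matrix.mulVec V.1 ψ)
    | .prep s' => haltProb A U bits good n q s' (applyHyp U ψ)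
    | .prepInv s' => haltProb A U bits good n q s' (applyHyp U.conjTranspose ψ)
    | .query e s' =>
      match q with
      | 0 => 0
      | q' + 1 => haltProb A U bits good n q' s' (applyOracle (bits e) ψ)
    | .measure _ c next => ∑ o, haltProb A U bits good n q (next o) (project c o ψ)

/-- With probability at least `p`, the algorithm halts after at most `q` oracle queries with an
output that satisfies `good`. -/
def SucceedsWithin {X 𝓔 : Type} [Fintype X] [DecidableEq X] {m : ℕ}
    {W : Type} [Fintype W] [DecidableEq W] {S Out : Type}
    (A : Algorithm X 𝓔 m W S Out) (U : Matrix X X ℂ) (bits : 𝓔 → X → Bits m)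
    (good : Out → Prop) (q : ℕ) (p : ℝ) : Prop :=
  ∃ n : ℕ, p ≤ haltProb A U bits good n q A.init (basisKet A.start)

/-- The leading term `L D² Δλ / (ε p)` of the query count. -/
def leadingCost (L D : ℕ) (Δlam ε p : ℝ) : ℝ := L * (D : ℝ) ^ 2 * Δlam / (ε * p)

/-- The soft-O bound `C T log(2 + T)^c` at success probability `1 - η`, which costs a further
factor `log (2 / η)`. -/
def softBound (C : ℝ) (c : ℕ) (T η : ℝ) : ℝ :=
  C * T * Real.log (2 + T) ^ c * Real.log (2 / η)

end SemiClassicalBayes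

end

/-!
The algorithm estimates, by amplitude estimation, the weighted sums `∑ x, P x * (f x * a x)`, where
`a x = ∏ₖ P(Eₖ|x) / Γ_{Eₖ}` is the relative likelihood of the evidence and `f` is `1` or one of the
functions `(x_i - λ_i) / Δλ` and `(x_i x_j - λ_ij) / Δλ`, all bounded by `1` in absolute value. The
ratios of these sums to the sum `p` for `f = 1` are the rescaled posterior moments, so additive
accuracy `δ` gives the moments to within `2 δ Δλ / p`, and `δ` of order `ε p / Δλ` suffices.

*One estimate.* With `L` queries, the prior state is prepared, the likelihoods are read into slots
of the workspace, and a flag is rotated so that it is raised with probability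
`5/32 + (3/32) ∑ x, P x * (f x * a x) = sin² (φ / 2)` (`sum_flag_encodeOps`). The offset keeps `φ`
in `[1/2, π/3]`. After `t` rounds of amplitude amplification the flag is raised with probability
`sin² ((2 t + 1) φ / 2)` (`sum_normSq_groverOps`), so that a measured bit is a sign with mean
`cos ((2 t + 1) φ)`. Let `t` be uniform below `M`. The mean of sign times `cos ((2 t + 1) φ')` is,
as a function of `φ'`, a Dirichlet kernel with a peak of width `1 / M` at `φ`; its mirror image at
`-φ` is far away by the choice of the offset. A grid point with a high empirical score is therefore
within `8 / M` of `φ` (`abs_phaseEstimate_sub_le`), and by an exponential moment bound and a union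
bound over the grid, logarithmically many samples make the empirical scores reliable
(`le_iterMean_phaseEstimate`). No Fourier transform is needed.

*Unknown `p`.* Stage `k` estimates all moments with `M = 2 ^ (k + 4)` and stops as soon as the
estimate of `p` is large compared with the accuracy `4 / 2 ^ k`. If the estimates are accurate, a
stop is justified (`isSemiClassicalModel_modelOf`) and happens at the latest when `2 ^ k` is of
order `Δλ / (ε p)`. Stage `k` fails with probability at most `η / 2 ^ (k + 1)`, and the query counts
form a geometric sum dominated by the last stage (`achieves_stages`, `queries_le_softBound`).

*Output.* The algorithm outputs the mean and the covariance of any distribution on the hypotheses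
whose moments are consistent with the estimates. The posterior is one, so there are such
distributions, and the covariance matrix of a distribution is positive semidefinite.

If `Δλ ≤ ε / 6`, a point mass is good enough and no query is made; this also ensures that the
leading term of the query count is bounded below in the remaining case.

Runs are handled by a program logic: `Achieves σ s ψ q p` says that from state `ψ` the program `s`
succeeds with weight at least `p` within `q` queries, and there is one rule for each construct.
After every measurement the registers are restored to the initial basis state, so that the
subroutines compose like classical randomised ones.
-/

noncomputable section

namespace SemiClassicalBayes

/-! ### Quantum programs and their success probability -/

section Logic

variable {X 𝓔 : Type} {m : ℕ} {W S Out : Type}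

lemma applyOracle_smul (f : X → Bits m) (a : ℂ) (ψ : Ket X m W) :
    applyOracle f (a • ψ) = a • applyOracle f ψ := rfl

lemma project_smul {r : ℕ} (c : Config X m W → Fin r) (o : Fin r) (a : ℂ) (ψ : Ket X m W) :
    project c o (a • ψ) = a • project c o ψ := by
  funext z
  simp [project]

variable [Fintype X]

lemma applyHyp_smul (U : Matrix X X ℂ) (a : ℂ) (ψ : Ket X m W) :
    applyHyp U (a • ψ) = a • applyHyp U ψ := by
  funext z
  simp only [applyHyp, Pi.smul_apply, smul_eq_mul, Finset.mul_sum]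
  exact Finset.sum_congr rfl fun _ _ => by ring

variable [Fintype W]

lemma normSq_nonneg (ψ : Ket X m W) : 0 ≤ normSq ψ :=
  Finset.sum_nonneg fun _ _ => by positivity

lemma normSq_smul (a : ℂ) (ψ : Ket X m W) : normSq (a • ψ) = ‖a‖ ^ 2 * normSq ψ := by
  simp [normSq, Finset.mul_sum, mul_pow]

variable [DecidableEq X] [DecidableEq W]
variable (A : Algorithm X 𝓔 m W S Out) (U : Matrix X X ℂ) (bits : 𝓔 → X → Bits m)
  (good : Out → Prop)

lemma haltProb_nonneg (n q : ℕ) (s : S) (ψ : Ket X m W) :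
    0 ≤ haltProb A U bits good n q s ψ := by
  induction n generalizing q s ψ with
  | zero => simp [haltProb]
  | succ n ih =>
    rw [haltProb]
    cases A.step s with
    | halt o => dsimp only; split_ifs <;> simp [normSq_nonneg]
    | gate V s' => exact ih _ _ _
    | prep s' => exact ih _ _ _
    | prepInv s' => exact ih _ _ _
    | query e s' =>
      cases q with
      | zero => simp
      | succ q => exact ih _ _ _
    | measure r c next => exact Finset.sum_nonneg fun _ _ => ih _ _ _

lemma haltProb_le_succ (n q : ℕ) (s : S) (ψ : Ket X m W) :
    haltProb A U bits good n q s ψ ≤ haltProb A U bits good (n + 1) q s ψ := by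
  induction n generalizing q s ψ with
  | zero => simpa [haltProb] using haltProb_nonneg A U bits good 1 q s ψ
  | succ n ih =>
    rw [haltProb, haltProb]
    cases A.step s with
    | halt o => exact le_rfl
    | gate V s' => exact ih _ _ _
    | prep s' => exact ih _ _ _
    | prepInv s' => exact ih _ _ _
    | query e s' =>
      cases q with
      | zero => simp
      | succ q => exact ih _ _ _
    | measure r c next => exact Finset.sum_le_sum fun _ _ => ih _ _ _

lemma haltProb_mono {n n' : ℕ} (h : n ≤ n') (q : ℕ) (s : S) (ψ : Ket X m W) :
    haltProb A U bits good n q s ψ ≤ haltProb A U bits good n' q s ψ :=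
  monotone_nat_of_le_succ (fun k => haltProb_le_succ A U bits good k q s ψ) h

lemma haltProb_mono_budget {q q' : ℕ} (h : q ≤ q') (n : ℕ) (s : S) (ψ : Ket X m W) :
    haltProb A U bits good n q s ψ ≤ haltProb A U bits good n q' s ψ := by
  induction n generalizing q q' s ψ with
  | zero => simp [haltProb]
  | succ n ih =>
    rw [haltProb, haltProb]
    cases A.step s with
    | halt o => exact le_rfl
    | gate V s' => exact ih h _ _
    | prep s' => exact ih h _ _
    | prepInv s' => exact ih h _ _
    | query e s' =>
      cases q with
      | zero =>
        cases q' with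
        | zero => exact le_rfl
        | succ q' => exact haltProb_nonneg A U bits good _ _ _ _
      | succ q =>
        obtain ⟨q', rfl⟩ : ∃ k, q' = k + 1 := ⟨q' - 1, by omega⟩
        exact ih (by omega) _ _
    | measure r c next => exact Finset.sum_le_sum fun _ _ => ih h _ _

/-- Branches of a measurement are unnormalised states, whose weight can be pulled out. -/
lemma haltProb_smul (n q : ℕ) (s : S) (a : ℂ) (ψ : Ket X m W) :
    haltProb A U bits good n q s (a • ψ) = ‖a‖ ^ 2 * haltProb A U bits good n q s ψ := by
  induction n generalizing q s ψ with
  | zero => simp [haltProb]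
  | succ n ih =>
    rw [haltProb, haltProb]
    cases A.step s with
    | halt o => dsimp only; split_ifs <;> simp [normSq_smul]
    | gate V s' => dsimp only; rw [Matrix.mulVec_smul, ih]
    | prep s' => dsimp only; rw [applyHyp_smul, ih]
    | prepInv s' => dsimp only; rw [applyHyp_smul, ih]
    | query e s' =>
      cases q with
      | zero => simp
      | succ q => dsimp only; rw [applyOracle_smul, ih]
    | measure r c next =>
      dsimp only
      rw [Finset.mul_sum]
      exact Finset.sum_congr rfl fun _ _ => by rw [project_smul, ih]

end Logic

/-- A unitary operation: a fixed gate, the preparation unitary or its inverse, or an oracle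
query. -/
inductive Op (X 𝓔 : Type) [Fintype X] [DecidableEq X] (m : ℕ)
    (W : Type) [Fintype W] [DecidableEq W] : Type where
  | gate (V : Matrix.unitaryGroup (Config X m W) ℂ)
  | prep
  | prepInv
  | query (e : 𝓔)

/-- Programs: finite decision trees of operations and measurements, whose leaves either halt or
jump to the procedure with the given number. The jumps make unbounded loops possible. -/
inductive Prog (X 𝓔 : Type) [Fintype X] [DecidableEq X] (m : ℕ)
    (W : Type) [Fintype W] [DecidableEq W] (Out : Type) : Type where
  | halt (o : Out)
  | op (g : Op X 𝓔 m W) (next : Prog X 𝓔 m W Out)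
  | measure (r : ℕ) (c : Config X m W → Fin r) (next : Fin r → Prog X 𝓔 m W Out)
  | jump (k : ℕ)

section Prog

variable {X 𝓔 : Type} [Fintype X] [DecidableEq X] {m : ℕ} {W : Type} [Fintype W] [DecidableEq W]
  {Out : Type}

/-- The effect of an operation on a state. -/
def Op.act (U : Matrix X X ℂ) (bits : 𝓔 → X → Bits m) : Op X 𝓔 m W → Ket X m W → Ket X m W
  | .gate V, ψ => Matrix.mulVec V.1 ψ
  | .prep, ψ => applyHyp U ψ
  | .prepInv, ψ => applyHyp U.conjTranspose ψ
  | .query e, ψ => applyOracle (bits e) ψ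

/-- The number of oracle queries made by an operation. -/
def Op.cost : Op X 𝓔 m W → ℕ
  | .query _ => 1
  | _ => 0

/-- The instruction at the root of a program, where `body k` is the procedure with number `k`.
A jump is carried out as an identity gate. -/
def Prog.instr (body : ℕ → Prog X 𝓔 m W Out) :
    Prog X 𝓔 m W Out → Instr X 𝓔 m W (Prog X 𝓔 m W Out) Out
  | .halt o => .halt o
  | .op (.gate V) p => .gate V p
  | .op .prep p => .prep p
  | .op .prepInv p => .prepInv p
  | .op (.query e) p => .query e p
  | .measure r c next => .measure r c next
  | .jump k => .gate 1 (body k)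

/-- The algorithm that starts with procedure `0`; its control states are the programs that remain
to be carried out. -/
def Prog.toAlgorithm (start : Config X m W) (body : ℕ → Prog X 𝓔 m W Out) :
    Algorithm X 𝓔 m W (Prog X 𝓔 m W Out) Out :=
  ⟨start, .jump 0, Prog.instr body⟩

/-- The data of a run that stay fixed: the initial basis state, the procedures, the black boxes,
and the outputs that count as a success. -/
structure Setting (X 𝓔 : Type) [Fintype X] [DecidableEq X] (m : ℕ)
    (W : Type) [Fintype W] [DecidableEq W] (Out : Type) where
  start : Config X m W
  body : ℕ → Prog X 𝓔 m W Out
  U : Matrix X X ℂ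
  bits : 𝓔 → X → Bits m
  good : Out → Prop

/-- With weight at least `p`, the program `s` run on the unnormalised state `ψ` halts successfully
after at most `q` queries. -/
def Achieves (σ : Setting X 𝓔 m W Out) (s : Prog X 𝓔 m W Out) (ψ : Ket X m W) (q : ℕ) (p : ℝ) :
    Prop :=
  ∃ n, p ≤ haltProb (Prog.toAlgorithm σ.start σ.body) σ.U σ.bits σ.good n q s ψ

variable {σ : Setting X 𝓔 m W Out}

lemma Achieves.weaken {s : Prog X 𝓔 m W Out} {ψ : Ket X m W} {q q' : ℕ} {p p' : ℝ}
    (h : Achieves σ s ψ q p) (hq : q ≤ q') (hp : p' ≤ p) : Achieves σ s ψ q' p' := by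
  obtain ⟨n, hn⟩ := h
  exact ⟨n, hp.trans (hn.trans (haltProb_mono_budget _ _ _ _ hq _ _ _))⟩

lemma achieves_zero (s : Prog X 𝓔 m W Out) (ψ : Ket X m W) (q : ℕ) : Achieves σ s ψ q 0 :=
  ⟨0, haltProb_nonneg _ _ _ _ _ _ _ _⟩

lemma achieves_halt {o : Out} (ho : σ.good o) (ψ : Ket X m W) :
    Achieves σ (.halt o) ψ 0 (normSq ψ) := by
  refine ⟨1, ?_⟩
  simp [haltProb, Prog.toAlgorithm, Prog.instr, ho]

lemma achieves_op {g : Op X 𝓔 m W} {s : Prog X 𝓔 m W Out} {ψ : Ket X m W} {q : ℕ} {p : ℝ}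
    (h : Achieves σ s (g.act σ.U σ.bits ψ) q p) : Achieves σ (.op g s) ψ (q + g.cost) p := by
  obtain ⟨n, hn⟩ := h
  refine ⟨n + 1, ?_⟩
  cases g <;> simpa [haltProb, Prog.toAlgorithm, Prog.instr, Op.act, Op.cost] using hn

lemma achieves_jump {k : ℕ} {ψ : Ket X m W} {q : ℕ} {p : ℝ}
    (h : Achieves σ (σ.body k) ψ q p) : Achieves σ (.jump k) ψ q p := by
  obtain ⟨n, hn⟩ := h
  refine ⟨n + 1, ?_⟩
  simpa [haltProb, Prog.toAlgorithm, Prog.instr] using hn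

lemma achieves_measure {r : ℕ} {c : Config X m W → Fin r} {next : Fin r → Prog X 𝓔 m W Out}
    {ψ : Ket X m W} {q : ℕ} {p : Fin r → ℝ}
    (h : ∀ o, Achieves σ (next o) (project c o ψ) q (p o)) :
    Achieves σ (.measure r c next) ψ q (∑ o, p o) := by
  choose n hn using h
  refine ⟨(Finset.univ.sup n) + 1, ?_⟩
  rw [haltProb]
  exact Finset.sum_le_sum fun o _ =>
    (hn o).trans (haltProb_mono _ _ _ _ (Finset.le_sup (Finset.mem_univ o)) _ _ _)

lemma Achieves.smul {s : Prog X 𝓔 m W Out} {ψ : Ket X m W} {q : ℕ} {p : ℝ}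
    (h : Achieves σ s ψ q p) (a : ℂ) : Achieves σ s (a • ψ) q (‖a‖ ^ 2 * p) := by
  obtain ⟨n, hn⟩ := h
  exact ⟨n, by rw [haltProb_smul]; gcongr⟩

/-- Carry out a list of operations, then continue with `s`. -/
def runOps (gs : List (Op X 𝓔 m W)) (s : Prog X 𝓔 m W Out) : Prog X 𝓔 m W Out :=
  gs.foldr Prog.op s

/-- The effect of a list of operations, the head of the list being applied first. -/
def actOps (U : Matrix X X ℂ) (bits : 𝓔 → X → Bits m) (gs : List (Op X 𝓔 m W))
    (ψ : Ket X m W) : Ket X m W :=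
  gs.foldl (fun φ g => g.act U bits φ) ψ

/-- The number of queries made by a list of operations. -/
def costOps (gs : List (Op X 𝓔 m W)) : ℕ := (gs.map Op.cost).sum

lemma achieves_runOps {gs : List (Op X 𝓔 m W)} {s : Prog X 𝓔 m W Out} {ψ : Ket X m W}
    {q : ℕ} {p : ℝ} (h : Achieves σ s (actOps σ.U σ.bits gs ψ) q p) :
    Achieves σ (runOps gs s) ψ (q + costOps gs) p := by
  induction gs generalizing ψ with
  | nil => simpa [runOps, actOps, costOps] using h
  | cons g gs ih =>
    have := achieves_op (ih (ψ := g.act σ.U σ.bits ψ) h)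
    exact this.weaken (by simp [costOps]; omega) le_rfl

/-- The gate that permutes the computational basis by an involution. -/
def permGate (f : Config X m W → Config X m W) (hf : Function.Involutive f) :
    Matrix.unitaryGroup (Config X m W) ℂ :=
  ⟨Matrix.of fun z z' => if f z = z' then 1 else 0, by
    rw [Matrix.mem_unitaryGroup_iff]
    ext z z'
    simp [Matrix.mul_apply, Matrix.one_apply, Matrix.star_apply, apply_ite, hf.injective.eq_iff,
      eq_comm]⟩

lemma permGate_mulVec (f : Config X m W → Config X m W) (hf : Function.Involutive f)
    (ψ : Ket X m W) (z : Config X m W) : Matrix.mulVec (permGate f hf).1 ψ z = ψ (f z) := by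
  simp [permGate, Matrix.mulVec, dotProduct]

/-- Measure all registers, restore the initial basis state `z₀`, and continue according to the
measured basis state. -/
def measureAll (z₀ : Config X m W) (next : Config X m W → Prog X 𝓔 m W Out) :
    Prog X 𝓔 m W Out :=
  .measure (Fintype.card (Config X m W)) (Fintype.equivFin _) fun o =>
    .op (.gate (permGate (Equiv.swap z₀ ((Fintype.equivFin _).symm o))
      (Equiv.swap_apply_self _ _))) (next ((Fintype.equivFin _).symm o))

lemma achieves_measureAll {z₀ : Config X m W} {next : Config X m W → Prog X 𝓔 m W Out}
    {ψ : Ket X m W} {q : ℕ} {p : Config X m W → ℝ}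
    (h : ∀ z, Achieves σ (next z) (basisKet z₀) q (p z)) :
    Achieves σ (measureAll z₀ next) ψ q (∑ z, ‖ψ z‖ ^ 2 * p z) := by
  have hsum : ∑ z, ‖ψ z‖ ^ 2 * p z
      = ∑ o, ‖ψ ((Fintype.equivFin (Config X m W)).symm o)‖ ^ 2
          * p ((Fintype.equivFin (Config X m W)).symm o) :=
    ((Fintype.equivFin (Config X m W)).symm.sum_comp _).symm
  rw [hsum]
  refine achieves_measure fun o => ?_
  set z := (Fintype.equivFin (Config X m W)).symm o with hz
  refine achieves_op (q := q) ?_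
  have hstate : (Op.gate (permGate (Equiv.swap z₀ z) (Equiv.swap_apply_self _ _)) :
      Op X 𝓔 m W).act σ.U σ.bits (project (Fintype.equivFin (Config X m W)) o ψ)
      = ψ z • basisKet z₀ := by
    funext y
    refine (permGate_mulVec _ _ _ y).trans ?_
    simp only [project, Pi.smul_apply, smul_eq_mul, basisKet]
    by_cases hy : y = z₀
    · subst hy; simp [hz]
    · have hne : Equiv.swap z₀ z y ≠ z := fun h' => hy (by
        rw [← Equiv.swap_apply_self z₀ z y, h', Equiv.swap_apply_right])
      have hne' : Fintype.equivFin (Config X m W) (Equiv.swap z₀ z y) ≠ o := fun h' =>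
        hne ((Equiv.symm_apply_apply _ _).symm.trans (congrArg _ h'))
      simp [hne', hy]
  rw [hstate]
  exact (h z).smul _

end Prog

/-! ### Amplitude amplification -/

lemma oracle_involutive {X W : Type} {m : ℕ} (f : X → Bits m) : Function.Involutive
    (fun z : Config X m W => (z.1, (fun i => xor (z.2.1 i) (f z.1 i)), z.2.2)) := by
  rintro ⟨x, y, w⟩
  simp

lemma applyHyp_eq_mulVec {X W : Type} [Fintype X] {m : ℕ} [Fintype W] [DecidableEq W]
    (U : Matrix X X ℂ) (ψ : Ket X m W) : applyHyp U ψ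
      = Matrix.mulVec (Matrix.kronecker U (1 : Matrix (Bits m × W) (Bits m × W) ℂ)) ψ := by
  funext z
  simp [applyHyp, Matrix.mulVec, dotProduct, Fintype.sum_prod_type, Matrix.one_apply,
    Matrix.kroneckerMap_apply, Prod.ext_iff, ite_and]

section Grover

variable {X 𝓔 : Type} [Fintype X] [DecidableEq X] {m : ℕ} {W : Type} [Fintype W] [DecidableEq W]

/-- The inverse of an operation. -/
def Op.inv : Op X 𝓔 m W → Op X 𝓔 m W
  | .gate V => .gate V⁻¹
  | .prep => .prepInv
  | .prepInv => .prep
  | .query e => .query e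

/-- The inverse of a list of operations. -/
def invOps (gs : List (Op X 𝓔 m W)) : List (Op X 𝓔 m W) := (gs.map Op.inv).reverse

lemma Op.cost_inv (g : Op X 𝓔 m W) : g.inv.cost = g.cost := by cases g <;> rfl

lemma costOps_append (gs hs : List (Op X 𝓔 m W)) :
    costOps (gs ++ hs) = costOps gs + costOps hs := by
  simp [costOps]

lemma costOps_invOps (gs : List (Op X 𝓔 m W)) : costOps (invOps gs) = costOps gs := by
  simp [costOps, invOps, Function.comp_def, Op.cost_inv, List.sum_reverse]

lemma actOps_append (U : Matrix X X ℂ) (bits : 𝓔 → X → Bits m) (gs hs : List (Op X 𝓔 m W))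
    (ψ : Ket X m W) : actOps U bits (gs ++ hs) ψ = actOps U bits hs (actOps U bits gs ψ) := by
  simp [actOps]

lemma exists_matrix_op {U : Matrix X X ℂ} (hU : U ∈ Matrix.unitaryGroup X ℂ)
    (bits : 𝓔 → X → Bits m) (g : Op X 𝓔 m W) :
    ∃ M ∈ Matrix.unitaryGroup (Config X m W) ℂ,
      (∀ ψ, g.act U bits ψ = Matrix.mulVec M ψ) ∧
      ∀ ψ, g.inv.act U bits ψ = Matrix.mulVec M.conjTranspose ψ := by
  have hK : Matrix.kronecker U (1 : Matrix (Bits m × W) (Bits m × W) ℂ)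
      ∈ Matrix.unitaryGroup (Config X m W) ℂ := Matrix.kronecker_mem_unitary hU (one_mem _)
  have hKH : (Matrix.kronecker U (1 : Matrix (Bits m × W) (Bits m × W) ℂ)).conjTranspose
      = Matrix.kronecker U.conjTranspose (1 : Matrix (Bits m × W) (Bits m × W) ℂ) := by
    simpa using Matrix.conjTranspose_kronecker U (1 : Matrix (Bits m × W) (Bits m × W) ℂ)
  cases g with
  | gate V => exact ⟨V.1, V.2, fun _ => rfl, fun _ => rfl⟩
  | prep => exact ⟨_, hK, applyHyp_eq_mulVec U, fun ψ => by rw [hKH]; exact applyHyp_eq_mulVec _ ψ⟩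
  | prepInv =>
    refine ⟨_, Unitary.star_mem hK, fun ψ => ?_, fun ψ => ?_⟩
    · rw [Matrix.star_eq_conjTranspose, hKH]; exact applyHyp_eq_mulVec _ ψ
    · rw [Matrix.star_eq_conjTranspose, Matrix.conjTranspose_conjTranspose]
      exact applyHyp_eq_mulVec _ ψ
  | query e =>
    have h : ∀ ψ : Ket X m W, applyOracle (bits e) ψ
        = Matrix.mulVec (permGate _ (oracle_involutive (W := W) (bits e))).1 ψ := fun ψ => by
      
      funext z
      exact Eq.trans rfl (permGate_mulVec _ (oracle_involutive (bits e)) ψ z).symm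
    refine ⟨_, (permGate _ (oracle_involutive (W := W) (bits e))).2, h, fun ψ => ?_⟩
    refine (h ψ).trans (congrArg (Matrix.mulVec · ψ) ?_)
    ext z z'
    have h' := (oracle_involutive (W := W) (bits e)).eq_iff (x := z) (y := z')
    simp only [permGate, Matrix.of_apply, Matrix.conjTranspose_apply]
    by_cases hz : (z.1, (fun i => xor (z.2.1 i) (bits e z.1 i)), z.2.2) = z'
    · rw [if_pos hz, if_pos (h'.1 hz).symm, star_one]
    · rw [if_neg hz, if_neg (fun h'' => hz (h'.2 h''.symm)), star_zero]

/-- A list of operations acts as a unitary matrix, the inverse list as its adjoint. -/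
lemma exists_matrix_actOps {U : Matrix X X ℂ} (hU : U ∈ Matrix.unitaryGroup X ℂ)
    (bits : 𝓔 → X → Bits m) (gs : List (Op X 𝓔 m W)) :
    ∃ M ∈ Matrix.unitaryGroup (Config X m W) ℂ,
      (∀ ψ, actOps U bits gs ψ = Matrix.mulVec M ψ) ∧
      ∀ ψ, actOps U bits (invOps gs) ψ = Matrix.mulVec M.conjTranspose ψ := by
  induction gs with
  | nil => exact ⟨1, one_mem _, fun ψ => by simp [actOps], fun ψ => by simp [actOps, invOps]⟩
  | cons g gs ih =>
    obtain ⟨M, hM, h1, h2⟩ := ih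
    obtain ⟨N, hN, h3, h4⟩ := exists_matrix_op hU bits g
    refine ⟨M * N, mul_mem hM hN, fun ψ => ?_, fun ψ => ?_⟩
    · rw [← Matrix.mulVec_mulVec, ← h3, ← h1]; rfl
    · rw [Matrix.conjTranspose_mul, ← Matrix.mulVec_mulVec, ← h2, ← h4]
      simp [invOps, actOps]

/-- The diagonal gate that changes the sign of the basis states satisfying `c`. -/
def signGate (c : Config X m W → Bool) : Matrix.unitaryGroup (Config X m W) ℂ :=
  ⟨Matrix.diagonal fun z => if c z then -1 else 1, by
    rw [Matrix.mem_unitaryGroup_iff, Matrix.star_eq_conjTranspose, Matrix.diagonal_conjTranspose,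
      Matrix.diagonal_mul_diagonal, ← Matrix.diagonal_one]
    congr 1
    funext z
    by_cases h : c z <;> simp [h]⟩

lemma signGate_mulVec (c : Config X m W → Bool) (ψ : Ket X m W) (z : Config X m W) :
    Matrix.mulVec (signGate c).1 ψ z = (if c z then -1 else 1) * ψ z := by
  simp [signGate, Matrix.mulVec_diagonal]

/-- One round of amplitude amplification for the state prepared by `gs` from the basis state `z₀`:
reflect about the unmarked basis states, then about the prepared state. -/
def groverStep (gs : List (Op X 𝓔 m W)) (z₀ : Config X m W) (mark : Config X m W → Bool) :
    List (Op X 𝓔 m W) :=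
  .gate (signGate mark) :: invOps gs ++ .gate (signGate fun z => z ≠ z₀) :: gs

/-- Prepare a state, then apply `t` rounds of amplitude amplification. -/
def groverOps (gs : List (Op X 𝓔 m W)) (z₀ : Config X m W) (mark : Config X m W → Bool) :
    ℕ → List (Op X 𝓔 m W)
  | 0 => gs
  | t + 1 => groverOps gs z₀ mark t ++ groverStep gs z₀ mark

lemma costOps_groverOps (gs : List (Op X 𝓔 m W)) (z₀ : Config X m W)
    (mark : Config X m W → Bool) (t : ℕ) :
    costOps (groverOps gs z₀ mark t) = (2 * t + 1) * costOps gs := by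
  induction t with
  | zero => simp [groverOps]
  | succ t ih =>
    have h : costOps (groverStep gs z₀ mark) = 2 * costOps gs := by
      have hc : ∀ (V : Matrix.unitaryGroup (Config X m W) ℂ) (hs : List (Op X 𝓔 m W)),
          costOps (.gate V :: hs) = costOps hs := fun V hs => by simp [costOps, Op.cost]
      rw [groverStep, List.cons_append, hc, costOps_append, hc, costOps_invOps]; ring
    rw [groverOps, costOps_append, ih, h]; ring

variable {U : Matrix X X ℂ} (bits : 𝓔 → X → Bits m)
  (gs : List (Op X 𝓔 m W)) (z₀ : Config X m W) (mark : Config X m W → Bool)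

/-- Amplification acts on the span of the marked and the unmarked part of the prepared state. -/
lemma actOps_groverStep (hU : U ∈ Matrix.unitaryGroup X ℂ) (v : Ket X m W) :
    actOps U bits (groverStep gs z₀ mark) v
      = fun z => 2 * (∑ y, star (actOps U bits gs (basisKet z₀) y)
          * ((if mark y then -1 else 1) * v y)) * actOps U bits gs (basisKet z₀) z
          - (if mark z then -1 else 1) * v z := by
  obtain ⟨M, hM, h1, h2⟩ := exists_matrix_actOps hU bits gs
  set v' : Ket X m W := fun z => (if mark z then -1 else 1) * v z with hv'
  set w : Ket X m W := Matrix.mulVec M.conjTranspose v' with hw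
  have e1 : actOps U bits (groverStep gs z₀ mark) v
      = Matrix.mulVec M (Matrix.mulVec (signGate fun z => z ≠ z₀).1 w) := by
    have hc : ∀ (V : Matrix.unitaryGroup (Config X m W) ℂ) (hs : List (Op X 𝓔 m W))
        (φ : Ket X m W), actOps U bits (.gate V :: hs) φ = actOps U bits hs (Matrix.mulVec V.1 φ) :=
      fun V hs φ => rfl
    rw [groverStep, List.cons_append, hc, actOps_append, hc, h2, h1, hw]
    have : Matrix.mulVec (signGate mark).1 v = v' := by
      funext z; rw [signGate_mulVec]
    rw [this]
  have e2 : Matrix.mulVec (signGate fun z => z ≠ z₀).1 w = (2 * w z₀) • basisKet z₀ - w := by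
    funext z
    rw [signGate_mulVec]
    by_cases hz : z = z₀
    · subst hz; simp [basisKet]; ring
    · simp [basisKet, hz]
  have e3 : w z₀ = ∑ y, star (actOps U bits gs (basisKet z₀) y) * v' y := by
    rw [hw, Matrix.mulVec, dotProduct]
    refine Finset.sum_congr rfl fun y _ => ?_
    rw [h1]
    simp [basisKet, Matrix.conjTranspose_apply]
  have e4 : Matrix.mulVec M w = v' := by
    rw [hw, Matrix.mulVec_mulVec, ← Matrix.star_eq_conjTranspose,
      (Matrix.mem_unitaryGroup_iff).1 hM, Matrix.one_mulVec]
  rw [e1, e2, Matrix.mulVec_sub, Matrix.mulVec_smul, e4, ← h1, e3]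
  funext z
  simp [hv']

/-- After `t` rounds the amplitude of the marked part is that of a rotation by `(2 t + 1) θ`. -/
lemma actOps_groverOps (hU : U ∈ Matrix.unitaryGroup X ℂ) {θ : ℝ}
    (hs : Real.sin θ ≠ 0) (hc : Real.cos θ ≠ 0)
    (hmark : ∑ z, (if mark z then ‖actOps U bits gs (basisKet z₀) z‖ ^ 2 else 0) = Real.sin θ ^ 2)
    (hrest : ∑ z, (if mark z then 0 else ‖actOps U bits gs (basisKet z₀) z‖ ^ 2) = Real.cos θ ^ 2)
    (t : ℕ) (z : Config X m W) :
    actOps U bits (groverOps gs z₀ mark t) (basisKet z₀) z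
      = ((if mark z then Real.sin ((2 * t + 1) * θ) / Real.sin θ
          else Real.cos ((2 * t + 1) * θ) / Real.cos θ : ℝ) : ℂ)
        * actOps U bits gs (basisKet z₀) z := by
  induction t generalizing z with
  | zero => simp [groverOps, hs, hc]
  | succ t ih =>
    set ψ := actOps U bits gs (basisKet z₀) with hψ
    set α := Real.sin ((2 * t + 1) * θ) / Real.sin θ with hα
    set β := Real.cos ((2 * t + 1) * θ) / Real.cos θ with hβ
    have hsum : ∑ y, star (ψ y) * ((if mark y then -1 else 1)
          * actOps U bits (groverOps gs z₀ mark t) (basisKet z₀) y)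
        = ((-α * Real.sin θ ^ 2 + β * Real.cos θ ^ 2 : ℝ) : ℂ) := by
      rw [← hmark, ← hrest, Finset.mul_sum, Finset.mul_sum, ← Finset.sum_add_distrib,
        Complex.ofReal_sum]
      refine Finset.sum_congr rfl fun y _ => ?_
      have hn : star (ψ y) * ψ y = ((‖ψ y‖ ^ 2 : ℝ) : ℂ) := by
        rw [Complex.star_def, Complex.conj_mul']; push_cast; rfl
      rw [ih y]
      by_cases hy : mark y
      · simp only [hy, if_true]
        rw [show star (ψ y) * (-1 * ((α : ℂ) * ψ y)) = -α * (star (ψ y) * ψ y) by ring, hn]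
        push_cast; ring
      · simp only [hy, Bool.false_eq_true, if_false]
        rw [show star (ψ y) * (1 * ((β : ℂ) * ψ y)) = β * (star (ψ y) * ψ y) by ring, hn]
        push_cast; ring
    have hang : ((2 * ((t + 1 : ℕ) : ℝ) + 1) * θ) = (2 * t + 1) * θ + 2 * θ := by push_cast; ring
    have hsc := Real.sin_sq_add_cos_sq θ
    have hαs : α * Real.sin θ = Real.sin ((2 * t + 1) * θ) := div_mul_cancel₀ _ hs
    have hβc : β * Real.cos θ = Real.cos ((2 * t + 1) * θ) := div_mul_cancel₀ _ hc
    rw [groverOps, actOps_append, actOps_groverStep bits gs z₀ mark hU, hsum]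
    beta_reduce
    rw [ih z]
    by_cases hz : mark z
    · simp only [hz, if_true]
      have : Real.sin ((2 * ((t + 1 : ℕ) : ℝ) + 1) * θ) / Real.sin θ
          = 2 * (-α * Real.sin θ ^ 2 + β * Real.cos θ ^ 2) + α := by
        rw [div_eq_iff hs, hang, Real.sin_add, Real.sin_two_mul, Real.cos_two_mul', ← hαs, ← hβc]
        linear_combination (α * Real.sin θ) * hsc
      rw [this]; push_cast; ring
    · simp only [hz, Bool.false_eq_true, if_false]
      have : Real.cos ((2 * ((t + 1 : ℕ) : ℝ) + 1) * θ) / Real.cos θ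
          = 2 * (-α * Real.sin θ ^ 2 + β * Real.cos θ ^ 2) - β := by
        rw [div_eq_iff hc, hang, Real.cos_add, Real.sin_two_mul, Real.cos_two_mul', ← hαs, ← hβc]
        linear_combination (-(β * Real.cos θ)) * hsc
      rw [this]; push_cast; ring

/-- The marked and unmarked probabilities after `t` rounds of amplification. -/
lemma sum_normSq_groverOps (hU : U ∈ Matrix.unitaryGroup X ℂ) {θ : ℝ}
    (hs : Real.sin θ ≠ 0) (hc : Real.cos θ ≠ 0)
    (hmark : ∑ z, (if mark z then ‖actOps U bits gs (basisKet z₀) z‖ ^ 2 else 0) = Real.sin θ ^ 2)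
    (hrest : ∑ z, (if mark z then 0 else ‖actOps U bits gs (basisKet z₀) z‖ ^ 2) = Real.cos θ ^ 2)
    (t : ℕ) (p : Bool → ℝ) :
    ∑ z, ‖actOps U bits (groverOps gs z₀ mark t) (basisKet z₀) z‖ ^ 2 * p (mark z)
      = Real.sin ((2 * t + 1) * θ) ^ 2 * p true + Real.cos ((2 * t + 1) * θ) ^ 2 * p false := by
  have h1 : Real.sin ((2 * t + 1) * θ) ^ 2
      = (Real.sin ((2 * t + 1) * θ) / Real.sin θ) ^ 2 * Real.sin θ ^ 2 := by
    rw [div_pow, div_mul_cancel₀ _ (pow_ne_zero 2 hs)]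
  have h2 : Real.cos ((2 * t + 1) * θ) ^ 2
      = (Real.cos ((2 * t + 1) * θ) / Real.cos θ) ^ 2 * Real.cos θ ^ 2 := by
    rw [div_pow, div_mul_cancel₀ _ (pow_ne_zero 2 hc)]
  rw [h1, h2, ← hmark, ← hrest, Finset.mul_sum, Finset.mul_sum, Finset.sum_mul, Finset.sum_mul,
    ← Finset.sum_add_distrib]
  refine Finset.sum_congr rfl fun z _ => ?_
  rw [actOps_groverOps bits gs z₀ mark hU hs hc hmark hrest t z, norm_mul, Complex.norm_real,
    mul_pow, Real.norm_eq_abs, sq_abs]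
  by_cases hz : mark z <;> simp [hz]

end Grover

/-! ### Encoding an expectation value in the probability of a flag -/

section Encoding

/-- The workspace: one slot for each likelihood of the evidence, and a flag. -/
abbrev Work (L m : ℕ) : Type := (Fin L → Bits m) × Bool

/-- The flag of a basis state. -/
def flag {X : Type} {m L : ℕ} (z : Config X m (Work L m)) : Bool := z.2.2.2

/-- All registers but the hypothesis register are zero. -/
def blank (m L : ℕ) : Bits m × Work L m := (fun _ => false, fun _ _ => false, false)

/-- Exchanging the likelihood register with a slot; this is how queried likelihoods are stored. -/
lemma slotSwap_involutive {X : Type} {m L : ℕ} (k : Fin L) : Function.Involutive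
    (fun z : Config X m (Work L m) =>
      (z.1, z.2.2.1 k, Function.update z.2.2.1 k z.2.1, z.2.2.2)) := by
  rintro ⟨x, y, s, b⟩
  simp

/-- The state in which every `x` has amplitude `a x` and the other registers hold `ℓ x`. -/
def labelKet {X W : Type} [DecidableEq W] {m : ℕ} (ℓ : X → Bits m × W) (a : X → ℂ) : Ket X m W :=
  fun z => if z.2 = ℓ z.1 then a z.1 else 0

lemma sum_normSq_labelKet {X W : Type} [Fintype X] [Fintype W] [DecidableEq W]
    {m : ℕ} (ℓ : X → Bits m × W) (a : X → ℂ) :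
    ∑ z, ‖labelKet ℓ a z‖ ^ 2 = ∑ x, ‖a x‖ ^ 2 := by
  rw [Fintype.sum_prod_type]
  refine Finset.sum_congr rfl fun x _ => ?_
  rw [Finset.sum_eq_single (ℓ x)]
  · simp [labelKet]
  · intro w _ hw; simp [labelKet, hw]
  · simp

variable {X 𝓔 : Type} [Fintype X] [DecidableEq X] {m L : ℕ}

/-- Entries of the rotation of a qubit by the angle `a`: the amplitude of `b` in the image
of `b'`. -/
def rot (a : ℝ) (b b' : Bool) : ℝ :=
  if b = b' then Real.cos a else if b then Real.sin a else -Real.sin a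

/-- The matrix that rotates the flag by an angle controlled by the other registers. -/
def rotMatrix (ang : X → Bits m → (Fin L → Bits m) → ℝ) :
    Matrix (Config X m (Work L m)) (Config X m (Work L m)) ℂ :=
  Matrix.of fun z z' =>
    if (z.1, z.2.1, z.2.2.1) = (z'.1, z'.2.1, z'.2.2.1) then
      (rot (ang z.1 z.2.1 z.2.2.1) z.2.2.2 z'.2.2.2 : ℂ) else 0

lemma rotMatrix_mulVec (ang : X → Bits m → (Fin L → Bits m) → ℝ)
    (ψ : Ket X m (Work L m)) (x : X) (y : Bits m) (s : Fin L → Bits m) (b : Bool) :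
    Matrix.mulVec (rotMatrix ang) ψ (x, y, s, b)
      = rot (ang x y s) b true * ψ (x, y, s, true)
        + rot (ang x y s) b false * ψ (x, y, s, false) := by
  simp [rotMatrix, Matrix.mulVec, dotProduct, Fintype.sum_prod_type, ite_and, Prod.ext_iff]

lemma rotMatrix_mul_star (ang : X → Bits m → (Fin L → Bits m) → ℝ) :
    rotMatrix ang * star (rotMatrix ang) = 1 := by
  have hstar : star (rotMatrix ang) = rotMatrix fun x y s => -ang x y s := by
    ext ⟨x, y, s, b⟩ ⟨x', y', s', b'⟩
    rw [Matrix.star_apply]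
    simp only [rotMatrix, Matrix.of_apply]
    by_cases h : (x, y, s) = (x', y', s')
    · simp only [Prod.mk.injEq] at h
      obtain ⟨rfl, rfl, rfl⟩ := h
      rw [if_pos rfl, if_pos rfl, Complex.star_def, Complex.conj_ofReal]
      cases b <;> cases b' <;> simp [rot]
    · rw [if_neg h, if_neg (Ne.symm h), star_zero]
  refine Matrix.ext_of_mulVec_single fun z => ?_
  rw [hstar, ← Matrix.mulVec_mulVec, Matrix.one_mulVec]
  generalize (Pi.single z 1 : Ket X m (Work L m)) = ψ
  funext ⟨x, y, s, b⟩
  have h : ((Real.sin (ang x y s) : ℂ)) ^ 2 + (Real.cos (ang x y s) : ℂ) ^ 2 = 1 := by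
    exact_mod_cast Real.sin_sq_add_cos_sq (ang x y s)
  rw [rotMatrix_mulVec, rotMatrix_mulVec, rotMatrix_mulVec]
  cases b <;> simp only [rot, Real.cos_neg, Real.sin_neg, if_true, if_false, reduceCtorEq,
    Complex.ofReal_neg, Bool.false_eq_true]
  · linear_combination ψ (x, y, s, false) * h
  · linear_combination ψ (x, y, s, true) * h

/-- The gate that rotates the flag by an angle controlled by the other registers. -/
def rotGate (ang : X → Bits m → (Fin L → Bits m) → ℝ) :
    Matrix.unitaryGroup (Config X m (Work L m)) ℂ :=
  ⟨rotMatrix ang, Matrix.mem_unitaryGroup_iff.2 (rotMatrix_mul_star ang)⟩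

/-- Read the likelihoods of the observations in the list `l` into their slots. -/
def readOps (E : Fin L → 𝓔) (l : List (Fin L)) : List (Op X 𝓔 m (Work L m)) :=
  l.flatMap fun k => [.query (E k), .gate (permGate _ (slotSwap_involutive k))]

lemma costOps_readOps (E : Fin L → 𝓔) (l : List (Fin L)) :
    costOps (readOps (X := X) (m := m) E l) = l.length := by
  induction l with
  | nil => rfl
  | cons k l ih =>
    rw [readOps, List.flatMap_cons, costOps_append]
    rw [readOps] at ih
    rw [ih]
    simp [costOps, Op.cost]; omega

lemma applyHyp_basisKet {W : Type} [Fintype W] [DecidableEq W] (U : Matrix X X ℂ) (x₀ : X)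
    (w : Bits m × W) : applyHyp U (basisKet (x₀, w)) = labelKet (fun _ => w) fun x => U x x₀ := by
  funext ⟨x, y⟩
  by_cases h : y = w <;> simp [applyHyp, basisKet, labelKet, Pi.single_apply, h]

/-- Each query writes into the empty likelihood register, and the exchange with an empty slot
empties the register again. -/
lemma actOps_readOps (U : Matrix X X ℂ) (bits : 𝓔 → X → Bits m) (E : Fin L → 𝓔)
    {l : List (Fin L)} (hl : l.Nodup) (s : X → Fin L → Bits m)
    (hs : ∀ x, ∀ k ∈ l, s x k = fun _ => false) (b : Bool) (a : X → ℂ) :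
    actOps U bits (readOps E l) (labelKet (fun x => (fun _ => false, s x, b)) a)
      = labelKet (fun x =>
          (fun _ => false, fun k => if k ∈ l then bits (E k) x else s x k, b)) a := by
  induction l generalizing s with
  | nil => simp [readOps, actOps]
  | cons k l ih =>
    rw [List.nodup_cons] at hl
    have h1 : actOps U bits [.query (E k), .gate (permGate _ (slotSwap_involutive k))]
        (labelKet (fun x => (fun _ => false, s x, b)) a)
        = labelKet (fun x => (fun _ => false, Function.update (s x) k (bits (E k) x), b)) a := by
      funext ⟨x, y, s', b'⟩
      simp only [actOps, List.foldl_cons, List.foldl_nil, Op.act]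
      rw [permGate_mulVec]
      simp only [applyOracle, labelKet]
      refine if_congr ?_ rfl rfl
      have hk := hs x k (by simp)
      simp only [Prod.mk.injEq]
      constructor
      · rintro ⟨h2, h3, h4⟩
        have hy : y = fun _ => false := by
          have := congrFun h3 k
          simpa [hk] using this
        refine ⟨hy, ?_, h4⟩
        rw [← h3, Function.update_idem]
        have : bits (E k) x = s' k := by
          funext i
          have := congrFun h2 i
          simp only [bne_eq_false_iff_eq] at this
          exact this.symm
        rw [this, Function.update_eq_self]
      · rintro ⟨rfl, rfl, rfl⟩
        refine ⟨by funext i; simp, ?_, rfl⟩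
        rw [Function.update_idem, ← hk, Function.update_eq_self]
    rw [readOps, List.flatMap_cons, actOps_append, h1]
    refine (ih hl.2 _ fun x j hj => ?_).trans ?_
    · have hjk : j ≠ k := by rintro rfl; exact hl.1 hj
      rw [Function.update_of_ne hjk]
      exact hs x j (List.mem_cons_of_mem _ hj)
    · congr 1
      funext x
      congr 2
      funext j
      by_cases hjk : j = k
      · subst hjk; simp [hl.1]
      · simp [hjk]

/-- Prepare the prior state, read all likelihoods, and rotate the flag so that it is raised with
probability `g x s`, where `s` are the contents of the slots. -/
def encodeOps (E : Fin L → 𝓔) (g : X → (Fin L → Bits m) → ℝ) : List (Op X 𝓔 m (Work L m)) :=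
  .prep :: readOps E (List.finRange L) ++
    [.gate (rotGate fun x _ s => Real.arcsin (Real.sqrt (g x s)))]

lemma costOps_encodeOps (E : Fin L → 𝓔) (g : X → (Fin L → Bits m) → ℝ) :
    costOps (encodeOps E g) = L := by
  have h := costOps_readOps (X := X) (m := m) E (List.finRange L)
  rw [encodeOps, costOps_append]
  simp only [costOps, List.map_cons, List.sum_cons, Op.cost, List.map_nil, List.sum_nil] at h ⊢
  rw [h]; simp

lemma actOps_encodeOps (U : Matrix X X ℂ) (bits : 𝓔 → X → Bits m) (E : Fin L → 𝓔)
    (g : X → (Fin L → Bits m) → ℝ) (x₀ : X) (z : Config X m (Work L m)) :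
    actOps U bits (encodeOps E g) (basisKet (x₀, blank m L)) z
      = labelKet (fun x => (fun _ => false, fun k => bits (E k) x, flag z))
          (fun x => U x x₀ * (rot (Real.arcsin (Real.sqrt (g x fun k => bits (E k) x)))
            (flag z) false : ℝ)) z := by
  obtain ⟨x, y, s, b⟩ := z
  have h1 : actOps U bits (encodeOps E g) (basisKet (x₀, blank m L))
      = Matrix.mulVec (rotMatrix fun x _ s => Real.arcsin (Real.sqrt (g x s)))
        (labelKet (fun x => (fun _ => false, fun k => bits (E k) x, false)) fun x => U x x₀) := by
    rw [encodeOps, actOps_append]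
    have : actOps U bits (.prep :: readOps E (List.finRange L)) (basisKet (x₀, blank m L))
        = labelKet (fun x => (fun _ => false, fun k => bits (E k) x, false)) fun x => U x x₀ := by
      have h2 := actOps_readOps U bits E (List.nodup_finRange L) (fun _ _ _ => false)
        (fun _ _ _ => rfl) false fun x => U x x₀
      simp only [List.mem_finRange, if_true] at h2
      rw [← h2, ← blank, ← applyHyp_basisKet]
      rfl
    rw [this]
    rfl
  rw [h1, rotMatrix_mulVec]
  simp only [labelKet, flag, Prod.mk.injEq, and_false, if_false, mul_zero, zero_add, and_true,
    reduceCtorEq]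
  by_cases h : y = (fun _ => false) ∧ s = fun k => bits (E k) x
  · rw [if_pos h, if_pos h, h.2]; ring
  · rw [if_neg h, if_neg h, mul_zero]

variable {P : X → ℝ} {U : Matrix X X ℂ} {x₀ : X} (bits : 𝓔 → X → Bits m) (E : Fin L → 𝓔)
  (g : X → (Fin L → Bits m) → ℝ)

/-- The probability that the flag is raised is the prior mean of the rotation probabilities. -/
lemma sum_flag_encodeOps (hP : ∀ x, 0 ≤ P x) (hU : ∀ x, U x x₀ = (Real.sqrt (P x) : ℂ))
    (hg : ∀ x, 0 ≤ g x (fun k => bits (E k) x) ∧ g x (fun k => bits (E k) x) ≤ 1) :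
    (∑ z, (if flag z then ‖actOps U bits (encodeOps E g) (basisKet (x₀, blank m L)) z‖ ^ 2 else 0)
      = ∑ x, P x * g x fun k => bits (E k) x) ∧
    ∑ z, (if flag z then 0 else ‖actOps U bits (encodeOps E g) (basisKet (x₀, blank m L)) z‖ ^ 2)
      = ∑ x, P x * (1 - g x fun k => bits (E k) x) := by
  have hsin : ∀ x, Real.sin (Real.arcsin (Real.sqrt (g x fun k => bits (E k) x))) ^ 2
      = g x fun k => bits (E k) x := fun x => by
    rw [Real.sin_arcsin (by linarith [Real.sqrt_nonneg (g x fun k => bits (E k) x)])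
      (Real.sqrt_le_one.2 (hg x).2), Real.sq_sqrt (hg x).1]
  have key : ∀ (b : Bool) (x : X), ‖U x x₀ * (rot (Real.arcsin (Real.sqrt
      (g x fun k => bits (E k) x))) b false : ℝ)‖ ^ 2
      = P x * (if b then g x (fun k => bits (E k) x) else 1 - g x fun k => bits (E k) x) := by
    intro b x
    rw [norm_mul, mul_pow, hU, Complex.norm_real, Complex.norm_real, Real.norm_eq_abs, sq_abs,
      Real.sq_sqrt (hP x), Real.norm_eq_abs, sq_abs]
    cases b
    · simp only [rot, if_true, Bool.false_eq_true, if_false, Real.cos_sq', hsin]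
    · simp only [rot, reduceCtorEq, if_false, if_true, hsin]
  have aux : ∀ b : Bool, ∑ z, (if flag z = b then
      ‖actOps U bits (encodeOps E g) (basisKet (x₀, blank m L)) z‖ ^ 2 else 0)
      = ∑ x, P x * (if b then g x (fun k => bits (E k) x) else 1 - g x fun k => bits (E k) x) := by
    intro b
    simp only [← key b]
    rw [← sum_normSq_labelKet (fun x => ((fun _ => false : Bits m), fun k => bits (E k) x, b))]
    refine Finset.sum_congr rfl fun z _ => ?_
    by_cases hz : flag z = b
    · rw [if_pos hz, actOps_encodeOps, hz]
    · rw [if_neg hz, labelKet, if_neg]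
      · simp
      · intro h; exact hz (by rw [flag, h])
  constructor
  · simpa using aux true
  · have := aux false
    simp only [Bool.false_eq_true, if_false] at this
    rw [← this]
    refine Finset.sum_congr rfl fun z _ => ?_
    cases flag z <;> simp

end Encoding

/-! ### Phase estimation from measured bits -/

section Statistics

/-- The mean of `F` over `n` independent samples from the distribution with weights `w` on `s`. -/
def iterMean {Ω : Type} (s : Finset Ω) (w : Ω → ℝ) : ℕ → (List Ω → ℝ) → ℝ
  | 0, F => F []
  | n + 1, F => ∑ ω ∈ s, w ω * iterMean s w n fun l => F (ω :: l)

/-- The union bound in exponential form: exponentials of sums of independent terms have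
multiplicative means. -/
lemma le_iterMean {Ω ι : Type} {s : Finset Ω} {w : Ω → ℝ} (hw : ∀ ω ∈ s, 0 ≤ w ω)
    (hw1 : ∑ ω ∈ s, w ω = 1) (I : Finset ι) (y : ι → Ω → ℝ) (p : ℝ) (n : ℕ) (c : ι → ℝ)
    (F : List Ω → ℝ)
    (hF : ∀ l : List Ω, l.length = n → p - ∑ i ∈ I, c i * Real.exp ((l.map (y i)).sum) ≤ F l) :
    p - ∑ i ∈ I, c i * (∑ ω ∈ s, w ω * Real.exp (y i ω)) ^ n ≤ iterMean s w n F := by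
  induction n generalizing c F with
  | zero => simpa [iterMean] using hF [] rfl
  | succ n ih =>
    have h : ∀ ω ∈ s, w ω * (p - ∑ i ∈ I, c i * Real.exp (y i ω)
        * (∑ ω ∈ s, w ω * Real.exp (y i ω)) ^ n)
        ≤ w ω * iterMean s w n fun l => F (ω :: l) := fun ω hω => by
      refine mul_le_mul_of_nonneg_left (ih (fun i => c i * Real.exp (y i ω)) _ fun l hl => ?_)
        (hw ω hω)
      have := hF (ω :: l) (by simp [hl])
      simpa [Real.exp_add, mul_assoc] using this
    refine le_trans (le_of_eq ?_) (Finset.sum_le_sum h)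
    simp only [mul_sub, Finset.sum_sub_distrib, ← Finset.sum_mul, hw1, one_mul, Finset.mul_sum]
    rw [Finset.sum_comm]
    congr 1
    refine Finset.sum_congr rfl fun i _ => ?_
    rw [pow_succ', Finset.sum_mul, Finset.mul_sum]
    exact Finset.sum_congr rfl fun ω _ => by ring

/-- A Chernoff moment bound for a centred variable `d` with `|d| ≤ 2` and the deviation `1 / 8`.
With `exp x ≤ 1 + x + x ^ 2` the best exponential rate is `1 / 64`. -/
lemma sum_exp_le {Ω : Type} {s : Finset Ω} {w : Ω → ℝ} (hw : ∀ ω ∈ s, 0 ≤ w ω)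
    (hw1 : ∑ ω ∈ s, w ω = 1) {d : Ω → ℝ} (hd : ∀ ω ∈ s, |d ω| ≤ 2)
    (hd0 : ∑ ω ∈ s, w ω * d ω = 0) :
    ∑ ω ∈ s, w ω * Real.exp ((d ω - 1 / 8) / 64) ≤ Real.exp (-1 / 1024) := by
  have h : ∀ ω ∈ s, w ω * Real.exp ((d ω - 1 / 8) / 64)
      ≤ Real.exp (-1 / 512) * (w ω * (1 + 1 / 1024) + w ω * d ω / 64) := fun ω hω => by
    have hb := hd ω hω
    have h1 : |d ω / 64| ≤ 1 := by rw [abs_div]; norm_num; linarith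
    have h2 := (abs_le.1 (Real.abs_exp_sub_one_sub_id_le h1)).2
    have h3 : (d ω / 64) ^ 2 ≤ 1 / 1024 := by
      have := sq_le_sq' (neg_le_of_abs_le hb) (le_of_abs_le hb)
      rw [div_pow]; linarith
    have h4 : Real.exp ((d ω - 1 / 8) / 64) = Real.exp (-1 / 512) * Real.exp (d ω / 64) := by
      rw [← Real.exp_add]; congr 1; ring
    rw [h4, mul_left_comm]
    refine mul_le_mul_of_nonneg_left ?_ (Real.exp_pos _).le
    have h5 : Real.exp (d ω / 64) ≤ 1 + 1 / 1024 + d ω / 64 := by linarith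
    calc w ω * Real.exp (d ω / 64) ≤ w ω * (1 + 1 / 1024 + d ω / 64) :=
          mul_le_mul_of_nonneg_left h5 (hw ω hω)
      _ = _ := by ring
  refine (Finset.sum_le_sum h).trans ?_
  rw [← Finset.mul_sum, Finset.sum_add_distrib, ← Finset.sum_mul, hw1, ← Finset.sum_div, hd0]
  have h6 : 1 + 1 / 1024 ≤ Real.exp (1 / 1024) := by
    have := Real.add_one_le_exp (1 / 1024); linarith
  calc Real.exp (-1 / 512) * (1 * (1 + 1 / 1024) + 0 / 64)
      = Real.exp (-1 / 512) * (1 + 1 / 1024) := by ring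
    _ ≤ Real.exp (-1 / 512) * Real.exp (1 / 1024) := by gcongr
    _ = Real.exp (-1 / 1024) := by rw [← Real.exp_add]; norm_num

/-- The probability that the flag reads `ω.2` after `ω.1` rounds of amplification, with `ω.1`
uniform below `M` and rotation angle `φ / 2`. -/
def bitWeight (M : ℕ) (φ : ℝ) (ω : ℕ × Bool) : ℝ :=
  (1 / M) * if ω.2 then Real.sin ((2 * ω.1 + 1) * (φ / 2)) ^ 2
    else Real.cos ((2 * ω.1 + 1) * (φ / 2)) ^ 2

/-- The outcomes of a round: a number of amplification rounds below `M`, and a bit. -/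
def outcomes (M : ℕ) : Finset (ℕ × Bool) := Finset.range M ×ˢ Finset.univ

/-- The score of the candidate phase `φ'` on an outcome. -/
def score (φ' : ℝ) (ω : ℕ × Bool) : ℝ :=
  (if ω.2 then -1 else 1) * Real.cos ((2 * ω.1 + 1) * φ')

/-- The mean score of the candidate phase `φ'` when the phase is `φ`. -/
def meanScore (M : ℕ) (φ φ' : ℝ) : ℝ :=
  (1 / M) * ∑ t ∈ Finset.range M, Real.cos ((2 * t + 1) * φ) * Real.cos ((2 * t + 1) * φ')

lemma bitWeight_nonneg (M : ℕ) (φ : ℝ) (ω : ℕ × Bool) : 0 ≤ bitWeight M φ ω := by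
  rw [bitWeight]; split_ifs <;> positivity

lemma sum_bitWeight {M : ℕ} (hM : M ≠ 0) (φ : ℝ) : ∑ ω ∈ outcomes M, bitWeight M φ ω = 1 := by
  have : (M : ℝ) ≠ 0 := by exact_mod_cast hM
  simp [outcomes, Finset.sum_product, bitWeight, ← mul_add, this]

lemma sum_bitWeight_score (M : ℕ) (φ φ' : ℝ) :
    ∑ ω ∈ outcomes M, bitWeight M φ ω * score φ' ω = meanScore M φ φ' := by
  rw [outcomes, Finset.sum_product, meanScore, Finset.mul_sum]
  refine Finset.sum_congr rfl fun t _ => ?_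
  have h : (2 * (t : ℝ) + 1) * φ = 2 * ((2 * t + 1) * (φ / 2)) := by ring
  rw [h, Real.cos_two_mul']
  simp [bitWeight, score]
  ring

lemma abs_score_le (φ' : ℝ) (ω : ℕ × Bool) : |score φ' ω| ≤ 1 := by
  have := Real.abs_cos_le_one ((2 * ω.1 + 1) * φ')
  rw [score, abs_mul]; split_ifs <;> simpa using this

/-- The Dirichlet kernel that governs the mean score. -/
def cosKernel (M : ℕ) (x : ℝ) : ℝ := ∑ t ∈ Finset.range M, Real.cos ((2 * t + 1) * x)

lemma two_sin_mul_cosKernel (M : ℕ) (x : ℝ) :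
    2 * Real.sin x * cosKernel M x = Real.sin (2 * M * x) := by
  induction M with
  | zero => simp [cosKernel]
  | succ M ih =>
    rw [cosKernel, Finset.sum_range_succ, mul_add, ← cosKernel, ih]
    have h1 : 2 * ((M + 1 : ℕ) : ℝ) * x = (2 * M + 1) * x + x := by push_cast; ring
    have h2 : 2 * (M : ℝ) * x = (2 * M + 1) * x - x := by ring
    rw [h1, h2, Real.sin_add, Real.sin_sub]; ring

lemma abs_cosKernel_le {M : ℕ} {x c : ℝ} (hc : 0 < c) (hx : c ≤ |Real.sin x|) :
    |cosKernel M x| ≤ 1 / (2 * c) := by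
  have h := congrArg abs (two_sin_mul_cosKernel M x)
  rw [abs_mul, abs_mul, abs_two] at h
  have h1 := Real.abs_sin_le_one (2 * M * x)
  rw [le_div_iff₀ (by positivity)]
  nlinarith [abs_nonneg (cosKernel M x)]

lemma cosKernel_ge {M : ℕ} (hM : M ≠ 0) {x : ℝ} (hx : |x| ≤ 1 / (4 * M)) :
    7 / 8 * M ≤ cosKernel M x := by
  have hM' : (0 : ℝ) < M := by positivity
  have h : ∀ t ∈ Finset.range M, (7 / 8 : ℝ) ≤ Real.cos ((2 * t + 1) * x) := fun t ht => by
    have ht' : (t : ℝ) + 1 ≤ M := by exact_mod_cast Finset.mem_range.1 ht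
    have h1 : |(2 * (t : ℝ) + 1) * x| ≤ 1 / 2 := by
      rw [abs_mul, abs_of_nonneg (by positivity : (0 : ℝ) ≤ 2 * t + 1)]
      calc (2 * (t : ℝ) + 1) * |x| ≤ (2 * M) * (1 / (4 * M)) := by
            gcongr; linarith
        _ = 1 / 2 := by field_simp; norm_num
    have h2 := Real.one_sub_sq_div_two_le_cos (x := (2 * (t : ℝ) + 1) * x)
    have h3 := sq_le_sq' (neg_le_of_abs_le h1) (le_of_abs_le h1)
    linarith
  have := Finset.card_nsmul_le_sum _ _ _ h
  rw [Finset.card_range, nsmul_eq_mul] at this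
  rw [cosKernel]; linarith

lemma meanScore_eq (M : ℕ) (φ φ' : ℝ) :
    meanScore M φ φ' = (1 / (2 * M)) * (cosKernel M (φ - φ') + cosKernel M (φ + φ')) := by
  have h : ∀ t : ℕ, Real.cos ((2 * t + 1) * φ) * Real.cos ((2 * t + 1) * φ')
      = 1 / 2 * (Real.cos ((2 * t + 1) * (φ - φ')) + Real.cos ((2 * t + 1) * (φ + φ'))) :=
    fun t => by
      rw [mul_sub, mul_add ((2 : ℝ) * t + 1) φ φ', Real.cos_sub, Real.cos_add]; ring
  rw [meanScore, cosKernel, cosKernel, ← Finset.sum_add_distrib]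
  simp only [h, ← Finset.mul_sum]
  rw [← mul_assoc]; congr 1
  rw [one_div, one_div, one_div, mul_inv]; ring

lemma half_mul_le_sin {x : ℝ} (h0 : 0 ≤ x) (h1 : x ≤ Real.pi / 2) : x / 2 ≤ Real.sin x := by
  have hpi := Real.pi_le_four
  have hpi' := Real.pi_gt_three
  refine le_trans ?_ (Real.mul_le_sin h0 h1)
  have : (1 : ℝ) / 2 ≤ 2 / Real.pi := by rw [div_le_div_iff₀] <;> linarith
  nlinarith

/-- The summed phase stays away from the zeros of the sine, so the reflected peak of the score is
negligible. -/
lemma abs_cosKernel_add_le {M : ℕ} (hM : 16 ≤ M) {φ φ' : ℝ} (h1 : 1 / 2 ≤ φ)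
    (h2 : φ ≤ Real.pi / 3) (h3 : 1 / 4 ≤ φ') (h4 : φ' ≤ 5 / 4) :
    |cosKernel M (φ + φ')| ≤ M / 8 := by
  have hpi := Real.pi_gt_three
  have hM' : (16 : ℝ) ≤ M := by exact_mod_cast hM
  have hs : (3 : ℝ) / 8 ≤ Real.sin (φ + φ') := by
    by_cases h : φ + φ' ≤ Real.pi / 2
    · have := half_mul_le_sin (by linarith) h
      linarith
    · have := half_mul_le_sin (x := Real.pi - (φ + φ')) (by linarith) (by linarith)
      rw [Real.sin_pi_sub] at this
      linarith
  refine (abs_cosKernel_le (c := 3 / 8) (by norm_num) (hs.trans (le_abs_self _))).trans ?_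
  linarith

open Classical in
/-- A candidate phase on the grid of width `1 / (4 M)` in `[1 / 4, 5 / 4]` that scores at least
`1 / 4` per sample, if there is one (and `0` otherwise). -/
def phaseEstimate (M : ℕ) (l : List (ℕ × Bool)) : ℝ :=
  if h : ∃ j : ℕ, M ≤ j ∧ j ≤ 5 * M ∧
      (l.length : ℝ) / 4 ≤ (l.map (score (j / (4 * M)))).sum then h.choose / (4 * M)
  else 0

/-- If all empirical scores are close to their means, the selected candidate is close to the
phase: the grid point next to the phase scores high, those far away score low. -/
lemma abs_phaseEstimate_sub_le {M : ℕ} (hM : 16 ≤ M) {φ : ℝ} (h1 : 1 / 2 ≤ φ)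
    (h2 : φ ≤ Real.pi / 3) {l : List (ℕ × Bool)}
    (hl : ∀ j ≤ 5 * M, |(l.map (score ((j : ℕ) / (4 * M)))).sum
      - l.length * meanScore M φ (j / (4 * M))| < l.length / 8) :
    |phaseEstimate M l - φ| ≤ 8 / M := by
  have hM0 : (16 : ℝ) ≤ M := by exact_mod_cast hM
  have hMpos : (0 : ℝ) < M := by linarith
  have hlen : (0 : ℝ) < l.length := by
    have := (abs_nonneg _).trans_lt (hl 0 (by omega)); linarith
  have hgrid : ∀ j : ℕ, M ≤ j → j ≤ 5 * M →
      (1 : ℝ) / 4 ≤ (j : ℝ) / (4 * M) ∧ (j : ℝ) / (4 * M) ≤ 5 / 4 := fun j hj hj' => by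
    have a : (M : ℝ) ≤ j := by exact_mod_cast hj
    have b : (j : ℝ) ≤ 5 * M := by exact_mod_cast hj'
    constructor
    · rw [div_le_div_iff₀ (by norm_num) (by positivity)]; linarith
    · rw [div_le_div_iff₀ (by positivity) (by norm_num)]; linarith
  have hex : ∃ j : ℕ, M ≤ j ∧ j ≤ 5 * M ∧
      (l.length : ℝ) / 4 ≤ (l.map (score (j / (4 * M)))).sum := by
    have hφ0 : 0 ≤ 4 * M * φ := by positivity
    -- The grid point just below the phase.
    set j := ⌊4 * M * φ⌋₊ with hj
    have hj1 : (j : ℝ) ≤ 4 * M * φ := Nat.floor_le hφ0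
    have hj2 : 4 * M * φ < j + 1 := Nat.lt_floor_add_one _
    have hjM : M ≤ j := by
      rw [hj, Nat.le_floor_iff hφ0]; nlinarith
    have hj5 : j ≤ 5 * M := by
      have : (j : ℝ) ≤ 5 * M := by nlinarith [Real.pi_lt_d2]
      exact_mod_cast this
    refine ⟨j, hjM, hj5, ?_⟩
    obtain ⟨h3, h4⟩ := hgrid j hjM hj5
    have hdist : |φ - j / (4 * M)| ≤ 1 / (4 * M) := by
      have : φ - j / (4 * M) = (4 * M * φ - j) / (4 * M) := by field_simp
      rw [this, abs_div, abs_of_pos (by positivity : (0 : ℝ) < 4 * M),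
        abs_of_nonneg (by linarith)]
      gcongr; linarith
    have k1 := cosKernel_ge (by omega) hdist
    have k2 := abs_le.1 (abs_cosKernel_add_le hM h1 h2 h3 h4)
    have k3 : 3 / 8 ≤ meanScore M φ (j / (4 * M)) := by
      rw [meanScore_eq, one_div_mul_eq_div, le_div_iff₀ (by positivity)]
      linarith [k2.1]
    have k4 := (abs_lt.1 (hl j hj5)).1
    nlinarith
  have hdef : phaseEstimate M l = hex.choose / (4 * M) := by
    rw [phaseEstimate, dif_pos hex]
  obtain ⟨c1, c2, c3⟩ := hex.choose_spec
  rw [hdef]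
  set j := hex.choose
  obtain ⟨h3, h4⟩ := hgrid j c1 c2
  by_contra hfar
  rw [not_le, abs_sub_comm] at hfar
  have hsin : 4 / M ≤ |Real.sin (φ - j / (4 * M))| := by
    have hx : |φ - j / (4 * M)| ≤ Real.pi / 2 := by
      rw [abs_le]; constructor <;> linarith [Real.pi_gt_three]
    have := half_mul_le_sin (abs_nonneg _) hx
    have h5 : Real.sin |φ - j / (4 * M)| ≤ |Real.sin (φ - j / (4 * M))| := by
      rcases abs_choice (φ - j / (4 * M)) with h | h
      · rw [h]; exact le_abs_self _
      · rw [h, Real.sin_neg]; exact neg_le_abs _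
    have h6 : (4 : ℝ) / M = (8 / M) / 2 := by ring
    linarith
  have k1 := abs_le.1 (abs_cosKernel_le (M := M) (by positivity) hsin)
  have k0 : 1 / (2 * (4 / (M : ℝ))) = M / 8 := by field_simp; norm_num
  rw [k0] at k1
  have k2 := abs_le.1 (abs_cosKernel_add_le hM h1 h2 h3 h4)
  have k3 : meanScore M φ (j / (4 * M)) ≤ 1 / 8 := by
    rw [meanScore_eq, one_div_mul_eq_div, div_le_iff₀ (by positivity)]
    linarith [k2.2, k1.2]
  have k4 := (abs_lt.1 (hl j c2)).2
  nlinarith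

/-- The phase estimate is within `8 / M` except with exponentially small probability. -/
lemma le_iterMean_phaseEstimate {M : ℕ} (hM : 16 ≤ M) {φ : ℝ} (h1 : 1 / 2 ≤ φ)
    (h2 : φ ≤ Real.pi / 3) (n : ℕ) {p : ℝ} (hp : p ≤ 1) {F : List (ℕ × Bool) → ℝ}
    (hF0 : ∀ l, 0 ≤ F l) (hF : ∀ l, |phaseEstimate M l - φ| ≤ 8 / M → p ≤ F l) :
    p - 12 * M * Real.exp (-n / 1024) ≤ iterMean (outcomes M) (bitWeight M φ) n F := by
  have hM1 : (1 : ℝ) ≤ M := by exact_mod_cast (by omega : 1 ≤ M)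
  -- One index for each grid point and each direction of deviation.
  set I : Finset (ℕ × Bool) := Finset.range (5 * M + 1) ×ˢ Finset.univ with hI
  set d : ℕ × Bool → ℕ × Bool → ℝ := fun i ω => (if i.2 then -1 else 1)
    * (score (i.1 / (4 * M)) ω - meanScore M φ (i.1 / (4 * M))) with hd
  set y : ℕ × Bool → ℕ × Bool → ℝ := fun i ω => (d i ω - 1 / 8) / 64 with hy
  have hsum : ∀ (i : ℕ × Bool) (l : List (ℕ × Bool)), (l.map (y i)).sum
      = ((if i.2 then -1 else 1) * ((l.map (score (i.1 / (4 * M)))).sum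
        - l.length * meanScore M φ (i.1 / (4 * M))) - l.length / 8) / 64 := by
    intro i l
    induction l with
    | nil => simp
    | cons ω l ih =>
      rw [List.map_cons, List.sum_cons, ih, List.map_cons, List.sum_cons, List.length_cons]
      simp only [hy, hd]; push_cast; ring
  have hw := fun ω (_ : ω ∈ outcomes M) => bitWeight_nonneg M φ ω
  have hw1 := sum_bitWeight (by omega : M ≠ 0) φ
  have hmean : ∀ φ', |meanScore M φ φ'| ≤ 1 := fun φ' => by
    rw [← sum_bitWeight_score, ← hw1]
    refine (Finset.abs_sum_le_sum_abs _ _).trans (Finset.sum_le_sum fun ω hω => ?_)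
    rw [abs_mul, abs_of_nonneg (hw ω hω)]
    exact mul_le_of_le_one_right (hw ω hω) (abs_score_le _ _)
  have hmom : ∀ i ∈ I, (∑ ω ∈ outcomes M, bitWeight M φ ω * Real.exp (y i ω)) ^ n
      ≤ Real.exp (-n / 1024) := fun i _ => by
    have h := sum_exp_le hw hw1 (d := d i) (fun ω _ => ?_) ?_
    · calc _ ≤ Real.exp (-1 / 1024) ^ n := by
            refine pow_le_pow_left₀ ?_ h n
            exact Finset.sum_nonneg fun ω hω => mul_nonneg (hw ω hω) (Real.exp_pos _).le
        _ = _ := by rw [← Real.exp_nat_mul]; congr 1; ring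
    · have h3 : |d i ω| = |score (i.1 / (4 * M)) ω - meanScore M φ (i.1 / (4 * M))| := by
        simp only [hd, abs_mul]; split_ifs <;> simp
      rw [h3]
      refine (abs_sub _ _).trans ?_
      linarith [abs_score_le (i.1 / (4 * M)) ω, hmean (i.1 / (4 * M))]
    · simp only [hd, mul_left_comm (bitWeight M φ _), ← Finset.mul_sum, mul_sub,
        Finset.sum_sub_distrib, sum_bitWeight_score, ← Finset.sum_mul, hw1]
      ring
  refine le_trans ?_ (le_iterMean hw hw1 I y p n (fun _ => 1) F fun l hl => ?_)
  · have hcard : (I.card : ℝ) ≤ 12 * M := by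
      rw [hI, Finset.card_product, Finset.card_range, Finset.card_univ, Fintype.card_bool]
      push_cast; linarith
    have := Finset.sum_le_card_nsmul I _ _ hmom
    rw [nsmul_eq_mul] at this
    simp only [one_mul]
    have h3 := mul_le_mul_of_nonneg_right hcard (Real.exp_pos (-(n : ℝ) / 1024)).le
    linarith
  · simp only [one_mul]
    by_cases hgood : |phaseEstimate M l - φ| ≤ 8 / M
    · have : 0 ≤ ∑ i ∈ I, Real.exp ((l.map (y i)).sum) :=
        Finset.sum_nonneg fun _ _ => (Real.exp_pos _).le
      linarith [hF l hgood]
    · have hbad : ∃ j ≤ 5 * M, (l.length : ℝ) / 8 ≤ |(l.map (score ((j : ℕ) / (4 * M)))).sum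
          - l.length * meanScore M φ (j / (4 * M))| := by
        by_contra! hcon
        exact hgood (abs_phaseEstimate_sub_le hM h1 h2 hcon)
      obtain ⟨j, hj, hdev⟩ := hbad
      -- A large deviation makes one of the exponentials at least `1`.
      have hone : ∃ i ∈ I, 0 ≤ (l.map (y i)).sum := by
        rcases le_abs.1 hdev with h | h
        · refine ⟨(j, false), by simp [hI]; omega, ?_⟩
          rw [hsum]
          simp only [Bool.false_eq_true, if_false, one_mul]
          linarith
        · refine ⟨(j, true), by simp [hI]; omega, ?_⟩
          rw [hsum]
          simp only [if_true]
          linarith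
      obtain ⟨i, hi, hi0⟩ := hone
      have := Finset.single_le_sum (f := fun i => Real.exp ((l.map (y i)).sum))
        (fun _ _ => (Real.exp_pos _).le) hi
      have h3 := Real.one_le_exp hi0
      linarith [hF0 l]

end Statistics

/-! ### Amplitude estimation programs -/

section Estimation

variable {X 𝓔 : Type} [Fintype X] [DecidableEq X] {m L : ℕ} {Out : Type}

/-- Toss a fair coin by rotating the flag of the initial state. -/
def coinProg (x₀ : X) (next : Bool → Prog X 𝓔 m (Work L m) Out) : Prog X 𝓔 m (Work L m) Out :=
  .op (.gate (rotGate fun _ _ _ => Real.pi / 4))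
    (measureAll (x₀, blank m L) fun z => next (flag z))

/-- Draw a number below `2 ^ k` uniformly, bit by bit. -/
def randProg (x₀ : X) : ℕ → (ℕ → Prog X 𝓔 m (Work L m) Out) → Prog X 𝓔 m (Work L m) Out
  | 0, next => next 0
  | k + 1, next => coinProg x₀ fun b => randProg x₀ k fun t => next (if b then 2 ^ k + t else t)

/-- Draw a number of amplification rounds below `2 ^ k` for the state prepared by `gs`, carry them
out, and measure. -/
def sampleProg (x₀ : X) (gs : List (Op X 𝓔 m (Work L m))) (k : ℕ)
    (next : ℕ × Bool → Prog X 𝓔 m (Work L m) Out) : Prog X 𝓔 m (Work L m) Out :=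
  randProg x₀ k fun t => runOps (groverOps gs (x₀, blank m L) flag t)
    (measureAll (x₀, blank m L) fun z => next (t, flag z))

/-- Take `n` independent samples. -/
def samplesProg (x₀ : X) (gs : List (Op X 𝓔 m (Work L m))) (k : ℕ) :
    ℕ → (List (ℕ × Bool) → Prog X 𝓔 m (Work L m) Out) → Prog X 𝓔 m (Work L m) Out
  | 0, next => next []
  | n + 1, next => sampleProg x₀ gs k fun ω => samplesProg x₀ gs k n fun l => next (ω :: l)

variable {σ : Setting X 𝓔 m (Work L m) Out} {x₀ : X}

lemma achieves_coinProg {next : Bool → Prog X 𝓔 m (Work L m) Out} {q : ℕ} {p : Bool → ℝ}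
    (h : ∀ b, Achieves σ (next b) (basisKet (x₀, blank m L)) q (p b)) :
    Achieves σ (coinProg x₀ next) (basisKet (x₀, blank m L)) q ((p false + p true) / 2) := by
  have key : ∑ z, ‖Matrix.mulVec (rotMatrix fun (_ : X) (_ : Bits m) (_ : Fin L → Bits m) =>
      Real.pi / 4) (basisKet (x₀, blank m L)) z‖ ^ 2 * p (flag z) = (p false + p true) / 2 := by
    have hz : ∀ z : Config X m (Work L m), ‖Matrix.mulVec (rotMatrix fun (_ : X) (_ : Bits m)
        (_ : Fin L → Bits m) => Real.pi / 4) (basisKet (x₀, blank m L)) z‖ ^ 2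
        = if (z.1, z.2.1, z.2.2.1) = (x₀, (fun _ => false), fun _ _ => false)
          then 1 / 2 else 0 := by
      rintro ⟨x, y, s, b⟩
      rw [rotMatrix_mulVec]
      have h2 : (Real.sqrt 2 / 2) ^ 2 = 1 / 2 := by
        rw [div_pow, Real.sq_sqrt (by norm_num)]; norm_num
      by_cases hc : (x, y, s) = (x₀, (fun _ => false), fun _ _ => false)
      · rw [if_pos hc]
        simp only [Prod.mk.injEq] at hc
        obtain ⟨rfl, rfl, rfl⟩ := hc
        have e1 : basisKet (x, blank m L) (x, (fun _ => false), (fun _ _ => false), true) = 0 := by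
          simp [basisKet, blank]
        have e2 : basisKet (x, blank m L) (x, (fun _ => false), (fun _ _ => false), false) = 1 := by
          simp [basisKet, blank]
        rw [e1, e2, mul_zero, zero_add, mul_one, Complex.norm_real, Real.norm_eq_abs, sq_abs, rot,
          Real.cos_pi_div_four, Real.sin_pi_div_four]
        cases b <;> simpa using h2
      · rw [if_neg hc]
        have e : ∀ b', basisKet (x₀, blank m L) (x, y, s, b') = 0 := fun b' => by
          rw [basisKet, Pi.single_apply, if_neg]
          intro h; apply hc
          simp only [blank, Prod.mk.injEq] at h ⊢
          exact ⟨h.1, h.2.1, h.2.2.1⟩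
        simp [e]
    simp only [hz, Fintype.sum_prod_type, Prod.mk.injEq, ite_and, flag]
    simp
    ring
  rw [← key]
  exact achieves_op (q := q) (achieves_measureAll fun z => h (flag z))

lemma achieves_randProg {k : ℕ} {next : ℕ → Prog X 𝓔 m (Work L m) Out} {q : ℕ} {p : ℕ → ℝ}
    (h : ∀ t < 2 ^ k, Achieves σ (next t) (basisKet (x₀, blank m L)) q (p t)) :
    Achieves σ (randProg x₀ k next) (basisKet (x₀, blank m L)) q
      ((1 / 2 ^ k) * ∑ t ∈ Finset.range (2 ^ k), p t) := by
  induction k generalizing next p with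
  | zero => simpa [randProg] using h 0 (by simp)
  | succ k ih =>
    have h1 := achieves_coinProg (σ := σ) (x₀ := x₀) (q := q)
      (p := fun b => (1 / 2 ^ k) * ∑ t ∈ Finset.range (2 ^ k), p (if b then 2 ^ k + t else t))
      (fun b => ih (next := fun t => next (if b then 2 ^ k + t else t))
        (p := fun t => p (if b then 2 ^ k + t else t)) fun t ht => h _ (by
          rw [pow_succ]; split_ifs <;> omega))
    refine h1.weaken le_rfl (le_of_eq ?_)
    simp only [Bool.false_eq_true, if_false, if_true]
    rw [show 2 ^ (k + 1) = 2 ^ k + 2 ^ k by rw [pow_succ, mul_two], Finset.sum_range_add, pow_succ]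
    field_simp

variable {gs : List (Op X 𝓔 m (Work L m))} {k : ℕ} {φ : ℝ}

/-- The rotation angle of the state prepared by `gs` is `φ / 2`, strictly inside the first
quadrant. -/
structure HasPhase (σ : Setting X 𝓔 m (Work L m) Out) (x₀ : X) (gs : List (Op X 𝓔 m (Work L m)))
    (φ : ℝ) : Prop where
  sin_ne : Real.sin (φ / 2) ≠ 0
  cos_ne : Real.cos (φ / 2) ≠ 0
  mark : ∑ z, (if flag z then
    ‖actOps σ.U σ.bits gs (basisKet (x₀, blank m L)) z‖ ^ 2 else 0) = Real.sin (φ / 2) ^ 2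
  rest : ∑ z, (if flag z then 0 else
    ‖actOps σ.U σ.bits gs (basisKet (x₀, blank m L)) z‖ ^ 2) = Real.cos (φ / 2) ^ 2

lemma achieves_sampleProg (hU : σ.U ∈ Matrix.unitaryGroup X ℂ) (hφ : HasPhase σ x₀ gs φ)
    {next : ℕ × Bool → Prog X 𝓔 m (Work L m) Out} {q : ℕ} {p : ℕ × Bool → ℝ}
    (h : ∀ ω, Achieves σ (next ω) (basisKet (x₀, blank m L)) q (p ω)) :
    Achieves σ (sampleProg x₀ gs k next) (basisKet (x₀, blank m L)) (q + 2 ^ (k + 1) * costOps gs)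
      (∑ ω ∈ outcomes (2 ^ k), bitWeight (2 ^ k) φ ω * p ω) := by
  have h1 : ∀ t < 2 ^ k, Achieves σ (runOps (groverOps gs (x₀, blank m L) flag t)
      (measureAll (x₀, blank m L) fun z => next (t, flag z))) (basisKet (x₀, blank m L))
      (q + 2 ^ (k + 1) * costOps gs)
      (Real.sin ((2 * t + 1) * (φ / 2)) ^ 2 * p (t, true)
        + Real.cos ((2 * t + 1) * (φ / 2)) ^ 2 * p (t, false)) := fun t ht => by
    rw [← sum_normSq_groverOps σ.bits gs (x₀, blank m L) flag hU hφ.sin_ne hφ.cos_ne hφ.mark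
      hφ.rest t fun b => p (t, b)]
    refine (achieves_runOps (achieves_measureAll fun z => h (t, flag z))).weaken ?_ le_rfl
    rw [costOps_groverOps]
    have : 2 * t + 1 ≤ 2 ^ (k + 1) := by rw [pow_succ]; omega
    gcongr
  refine (achieves_randProg h1).weaken le_rfl (le_of_eq ?_)
  rw [outcomes, Finset.sum_product, Finset.mul_sum]
  refine Finset.sum_congr rfl fun t _ => ?_
  simp [bitWeight]; ring

lemma achieves_samplesProg (hU : σ.U ∈ Matrix.unitaryGroup X ℂ) (hφ : HasPhase σ x₀ gs φ) (n : ℕ)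
    {next : List (ℕ × Bool) → Prog X 𝓔 m (Work L m) Out} {q : ℕ} {p : List (ℕ × Bool) → ℝ}
    (h : ∀ l, Achieves σ (next l) (basisKet (x₀, blank m L)) q (p l)) :
    Achieves σ (samplesProg x₀ gs k n next) (basisKet (x₀, blank m L))
      (q + n * (2 ^ (k + 1) * costOps gs))
      (iterMean (outcomes (2 ^ k)) (bitWeight (2 ^ k) φ) n p) := by
  induction n generalizing next p with
  | zero => simpa [samplesProg, iterMean] using h []
  | succ n ih =>
    exact (achieves_sampleProg hU hφ fun ω => ih fun l => h (ω :: l)).weaken (by linarith) le_rfl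

variable (decode : Bits m → ℝ) (Γ : 𝓔 → ℝ) (E : Fin L → 𝓔)

/-- The probability `5/32 + (3/32) f(x) ∏ₖ P(Eₖ|x) / Γ_{Eₖ}` with which the flag is raised. For
`|f| ≤ 1` it lies in `[1/16, 1/4]`, so that the phase stays away from `0` and from `π / 2`, where
the estimation would be ambiguous. -/
def flagRate (f : X → ℝ) (x : X) (s : Fin L → Bits m) : ℝ :=
  5 / 32 + 3 / 32 * (f x * ∏ k, decode (s k) / Γ (E k))

/-- Estimate `∑ x, P x * (f x * ∏ₖ P(Eₖ|x) / Γ_{Eₖ})` from `n` samples with at most `2 ^ (k + 4)`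
rounds of amplification each, by inverting the affine map in `flagRate`. -/
def estimateProg (x₀ : X) (k n : ℕ) (f : X → ℝ) (next : ℝ → Prog X 𝓔 m (Work L m) Out) :
    Prog X 𝓔 m (Work L m) Out :=
  samplesProg x₀ (encodeOps E (flagRate decode Γ E f)) (k + 4) n fun l =>
    next (((1 - Real.cos (phaseEstimate (2 ^ (k + 4)) l)) / 2 - 5 / 32) * (32 / 3))

/-- Estimate the numbers of `estimateProg` for the functions `f i` with `i` in a list, and enter
them into `r`. -/
def estimatesProg {ι : Type} [DecidableEq ι] (x₀ : X) (k n : ℕ) (f : ι → X → ℝ) :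
    List ι → (ι → ℝ) → ((ι → ℝ) → Prog X 𝓔 m (Work L m) Out) → Prog X 𝓔 m (Work L m) Out
  | [], r, next => next r
  | i :: l, r, next => estimateProg decode Γ E x₀ k n (f i) fun y =>
      estimatesProg x₀ k n f l (Function.update r i y) next

variable {decode Γ E} {P : X → ℝ}

/-- What is known about the black boxes. -/
structure Admissible (σ : Setting X 𝓔 m (Work L m) Out) (x₀ : X) (decode : Bits m → ℝ) (Γ : 𝓔 → ℝ)
    (P : X → ℝ) : Prop where
  dist : IsDistribution P
  unitary : σ.U ∈ Matrix.unitaryGroup X ℂ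
  prior : ∀ x, σ.U x x₀ = (Real.sqrt (P x) : ℂ)
  lik : ∀ e x, 0 ≤ likelihood decode σ.bits e x ∧ likelihood decode σ.bits e x ≤ Γ e

/-- The joint likelihood of the evidence, relative to its upper bounds. -/
def relLik (decode : Bits m → ℝ) (bits : 𝓔 → X → Bits m) (Γ : 𝓔 → ℝ) (E : Fin L → 𝓔) (x : X) : ℝ :=
  ∏ k, likelihood decode bits (E k) x / Γ (E k)

/-- The number `∑ x, P x * (f x * ∏ₖ P(Eₖ|x) / Γ_{Eₖ})`. -/
def weighted (decode : Bits m → ℝ) (bits : 𝓔 → X → Bits m) (Γ : 𝓔 → ℝ) (E : Fin L → 𝓔) (P : X → ℝ)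
    (f : X → ℝ) : ℝ :=
  ∑ x, P x * (f x * relLik decode bits Γ E x)

lemma relLik_mem (hσ : Admissible σ x₀ decode Γ P) (x : X) :
    0 ≤ relLik decode σ.bits Γ E x ∧ relLik decode σ.bits Γ E x ≤ 1 := by
  have h : ∀ k, 0 ≤ likelihood decode σ.bits (E k) x / Γ (E k) ∧
      likelihood decode σ.bits (E k) x / Γ (E k) ≤ 1 := fun k => by
    obtain ⟨h1, h2⟩ := hσ.lik (E k) x
    exact ⟨div_nonneg h1 (h1.trans h2), div_le_one_of_le₀ h2 (h1.trans h2)⟩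
  exact ⟨Finset.prod_nonneg fun k _ => (h k).1,
    Finset.prod_le_one (fun k _ => (h k).1) fun k _ => (h k).2⟩

/-- The state prepared for the function `f` has a phase in `[1/2, π/3]`, whose cosine is an affine
function of the weighted sum to be estimated. -/
lemma exists_hasPhase (hσ : Admissible σ x₀ decode Γ P) {f : X → ℝ} (hf : ∀ x, |f x| ≤ 1) :
    ∃ φ, 1 / 2 ≤ φ ∧ φ ≤ Real.pi / 3 ∧
      Real.cos φ = 1 - 2 * (5 / 32 + 3 / 32 * weighted decode σ.bits Γ E P f) ∧
      HasPhase σ x₀ (encodeOps E (flagRate decode Γ E f)) φ := by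
  have hfa : ∀ x, |f x * relLik decode σ.bits Γ E x| ≤ 1 := fun x => by
    obtain ⟨h1, h2⟩ := relLik_mem (E := E) hσ x
    rw [abs_mul, abs_of_nonneg h1]
    exact mul_le_one₀ (hf x) h1 h2
  have hrate : ∀ x, flagRate decode Γ E f x (fun k => σ.bits (E k) x)
      = 5 / 32 + 3 / 32 * (f x * relLik decode σ.bits Γ E x) := fun x => rfl
  have hS : |weighted decode σ.bits Γ E P f| ≤ 1 := by
    rw [weighted, ← hσ.dist.2]
    refine (Finset.abs_sum_le_sum_abs _ _).trans (Finset.sum_le_sum fun x _ => ?_)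
    rw [abs_mul, abs_of_nonneg (hσ.dist.1 x)]
    exact mul_le_of_le_one_right (hσ.dist.1 x) (hfa x)
  obtain ⟨hS1, hS2⟩ := abs_le.1 hS
  set S := weighted decode σ.bits Γ E P f with hSdef
  set φ := Real.arccos (1 - 2 * (5 / 32 + 3 / 32 * S)) with hφ
  have hcos : Real.cos φ = 1 - 2 * (5 / 32 + 3 / 32 * S) :=
    Real.cos_arccos (by linarith) (by linarith)
  have hφ0 : 0 ≤ φ := Real.arccos_nonneg _
  have hcos2 := Real.cos_sq (φ / 2)
  have hsin2 := Real.sin_sq (φ / 2)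
  rw [mul_div_cancel₀ φ two_ne_zero, hcos] at hcos2
  rw [hcos2] at hsin2
  obtain ⟨hm, hr⟩ := sum_flag_encodeOps σ.bits E (flagRate decode Γ E f) hσ.dist.1 hσ.prior
    (fun x => by
      rw [hrate]; obtain ⟨h1, h2⟩ := abs_le.1 (hfa x); constructor <;> linarith)
  have hsum : ∑ x, P x * flagRate decode Γ E f x (fun k => σ.bits (E k) x)
      = 5 / 32 + 3 / 32 * S := by
    simp only [hrate, mul_add, mul_left_comm (P _) (3 / 32 : ℝ), Finset.sum_add_distrib,
      ← Finset.sum_mul, ← Finset.mul_sum, hσ.dist.2, one_mul]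
    rfl
  refine ⟨φ, ?_, ?_, hcos, ?_, ?_, ?_, ?_⟩
  · have := Real.one_sub_sq_div_two_le_cos (x := φ)
    nlinarith
  · rw [hφ, ← Real.arccos_cos (x := Real.pi / 3) (by positivity) (by linarith [Real.pi_pos]),
      Real.cos_pi_div_three]
    exact Real.arccos_le_arccos (by linarith)
  · intro h; rw [h] at hsin2; linarith
  · intro h; rw [h] at hcos2; linarith
  · rw [hm, hsum, hsin2]; ring
  · simp only [mul_sub, mul_one, Finset.sum_sub_distrib, hσ.dist.2, hsum] at hr
    rw [hr, hcos2]; ring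

lemma achieves_estimateProg (hσ : Admissible σ x₀ decode Γ P) (k n : ℕ) {f : X → ℝ}
    (hf : ∀ x, |f x| ≤ 1) {next : ℝ → Prog X 𝓔 m (Work L m) Out} {q : ℕ} {p : ℝ} (hp0 : 0 ≤ p)
    (hp1 : p ≤ 1) (h : ∀ y, |y - weighted decode σ.bits Γ E P f| ≤ 4 / 2 ^ k →
      Achieves σ (next y) (basisKet (x₀, blank m L)) q p) :
    Achieves σ (estimateProg decode Γ E x₀ k n f next) (basisKet (x₀, blank m L))
      (q + n * (2 ^ (k + 5) * L)) (p - 192 * 2 ^ k * Real.exp (-n / 1024)) := by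
  classical
  obtain ⟨φ, h1, h2, hcos, hφ⟩ := exists_hasPhase (E := E) hσ hf
  set S := weighted decode σ.bits Γ E P f
  have hest : ∀ l, |phaseEstimate (2 ^ (k + 4)) l - φ| ≤ 8 / ((2 ^ (k + 4) : ℕ) : ℝ) →
      |((1 - Real.cos (phaseEstimate (2 ^ (k + 4)) l)) / 2 - 5 / 32) * (32 / 3) - S|
        ≤ 4 / 2 ^ k := by
    intro l hl
    have hk : 8 / ((2 ^ (k + 4) : ℕ) : ℝ) = (1 / 2) * (1 / 2 ^ k) := by
      push_cast; rw [pow_add]; field_simp; norm_num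
    have h3 : |Real.cos (phaseEstimate (2 ^ (k + 4)) l) - Real.cos φ|
        ≤ (1 / 2) * (1 / 2 ^ k) := by
      refine le_trans ?_ (hl.trans hk.le)
      have := Real.lipschitzWith_cos.dist_le_mul (phaseEstimate (2 ^ (k + 4)) l) φ
      simpa [Real.dist_eq] using this
    have h4 : ((1 - Real.cos (phaseEstimate (2 ^ (k + 4)) l)) / 2 - 5 / 32) * (32 / 3) - S
        = -(16 / 3) * (Real.cos (phaseEstimate (2 ^ (k + 4)) l) - Real.cos φ) := by
      rw [hcos]; ring
    rw [h4, abs_mul]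
    have h5 : (0 : ℝ) < 1 / 2 ^ k := by positivity
    have h6 : (4 : ℝ) / 2 ^ k = 4 * (1 / 2 ^ k) := by ring
    rw [h6, show |(-(16 / 3) : ℝ)| = 16 / 3 by norm_num]
    linarith
  have hmain := achieves_samplesProg (k := k + 4) hσ.unitary hφ n
    (next := fun l =>
      next (((1 - Real.cos (phaseEstimate (2 ^ (k + 4)) l)) / 2 - 5 / 32) * (32 / 3)))
    (q := q) (p := fun l => if |phaseEstimate (2 ^ (k + 4)) l - φ|
      ≤ 8 / ((2 ^ (k + 4) : ℕ) : ℝ) then p else 0)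
    (fun l => by
      by_cases hl : |phaseEstimate (2 ^ (k + 4)) l - φ| ≤ 8 / ((2 ^ (k + 4) : ℕ) : ℝ)
      · rw [if_pos hl]; exact h _ (hest l hl)
      · rw [if_neg hl]; exact achieves_zero _ _ _)
  refine hmain.weaken (by rw [costOps_encodeOps]) ?_
  refine le_trans (le_of_eq ?_) (le_iterMean_phaseEstimate (M := 2 ^ (k + 4)) ?_ h1 h2 n hp1
    (fun l => by split_ifs <;> simp [hp0]) fun l hl => by rw [if_pos hl])
  · push_cast; rw [pow_add]; ring
  · rw [pow_add]; have := Nat.one_le_two_pow (n := k); omega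

/-- If all entries of `r` outside the list are accurate, then after the list has been worked off
all entries are accurate, except with the accumulated failure probability. -/
lemma achieves_estimatesProg {ι : Type} [DecidableEq ι] (hσ : Admissible σ x₀ decode Γ P)
    (k n : ℕ) {f : ι → X → ℝ} (hf : ∀ i x, |f i x| ≤ 1)
    {next : (ι → ℝ) → Prog X 𝓔 m (Work L m) Out} {q : ℕ} {p : ℝ} (hp1 : p ≤ 1)
    (h : ∀ r, (∀ i, |r i - weighted decode σ.bits Γ E P (f i)| ≤ 4 / 2 ^ k) →
      Achieves σ (next r) (basisKet (x₀, blank m L)) q p)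
    (l : List ι) (r : ι → ℝ)
    (hr : ∀ i, i ∈ l ∨ |r i - weighted decode σ.bits Γ E P (f i)| ≤ 4 / 2 ^ k) :
    Achieves σ (estimatesProg decode Γ E x₀ k n f l r next) (basisKet (x₀, blank m L))
      (q + l.length * (n * (2 ^ (k + 5) * L)))
      (p - l.length * (192 * 2 ^ k * Real.exp (-n / 1024))) := by
  induction l generalizing r with
  | nil => simpa [estimatesProg] using h r (by simpa using hr)
  | cons i l ih =>
    set c := 192 * 2 ^ k * Real.exp (-(n : ℝ) / 1024) with hc
    have hc0 : 0 ≤ c := by positivity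
    by_cases hp : 0 ≤ p - l.length * c
    · have h1 := achieves_estimateProg (E := E) hσ k n (hf i) (q := q + l.length
        * (n * (2 ^ (k + 5) * L))) (next := fun y => estimatesProg decode Γ E x₀ k n f l
          (Function.update r i y) next) hp (by
          have : 0 ≤ l.length * c := by positivity
          linarith) (fun y hy => ih _ fun j => by
          by_cases hj : j = i
          · subst hj; right; simpa using hy
          · rw [Function.update_of_ne hj]
            simpa [hj] using hr j)
      refine h1.weaken (le_of_eq ?_) (le_of_eq ?_)
      · rw [List.length_cons]; ring
      · rw [List.length_cons]; push_cast; ring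
    · refine (achieves_zero _ _ _).weaken le_rfl ?_
      rw [List.length_cons]; push_cast; linarith

end Estimation

/-! ### From moment estimates to a semi-classical model -/

section Moments

variable {X 𝓔 : Type} [Fintype X] {D : ℕ}

lemma secondMoment_eq_covMatrix_add {v : X → Fin D → ℝ} {Q : X → ℝ} (hQ : ∑ x, Q x = 1)
    (i j : Fin D) : secondMoment v Q i j = covMatrix v Q i j + mean v Q i * mean v Q j := by
  have h : covMatrix v Q i j = ∑ x, (Q x * (v x i * v x j) - mean v Q j * (Q x * v x i)
      - mean v Q i * (Q x * v x j) + mean v Q i * mean v Q j * Q x) :=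
    Finset.sum_congr rfl fun x _ => by ring
  rw [h, Finset.sum_add_distrib, Finset.sum_sub_distrib, Finset.sum_sub_distrib, ← Finset.mul_sum,
    ← Finset.mul_sum, ← Finset.mul_sum, hQ]
  simp only [secondMoment, mean]
  ring

lemma covMatrix_posSemidef {v : X → Fin D → ℝ} {Q : X → ℝ} (hQ : ∀ x, 0 ≤ Q x) :
    (covMatrix v Q).PosSemidef := by
  have h : covMatrix v Q = ∑ x, Q x • Matrix.vecMulVec (fun i => v x i - mean v Q i)
      (star fun i => v x i - mean v Q i) := by
    ext i j
    simp [covMatrix, Matrix.sum_apply, Matrix.vecMulVec_apply]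
  rw [h]
  exact Matrix.posSemidef_sum _ fun x _ => (Matrix.posSemidef_vecMulVec_self_star _).smul (hQ x)

/-- The mean and covariance of any distribution whose first two moments agree with those of `Q`
to within `ε / 3` form a semi-classical model of `Q`. -/
lemma isSemiClassicalModel_of_close
    (F : (Fin D → ℝ) → Matrix (Fin D) (Fin D) ℝ → MeasureTheory.Measure (Fin D → ℝ))
    {v : X → Fin D → ℝ} {Q Q' : X → ℝ} {ε : ℝ} (hQ : IsDistribution Q) (hQ' : IsDistribution Q')
    (h1 : ∀ i, |mean v Q' i - mean v Q i| ≤ ε / 3)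
    (h2 : ∀ i j, |secondMoment v Q' i j - secondMoment v Q i j| ≤ ε / 3) :
    IsSemiClassicalModel F v Q ε (mean v Q', covMatrix v Q') := by
  have hε : ∀ i : Fin D, 0 ≤ ε := fun i => by linarith [(abs_nonneg _).trans (h1 i)]
  have h1' : ∀ i, |mean v Q' i - mean v Q i| ≤ ε := fun i => (h1 i).trans (by linarith [hε i])
  have h2' : ∀ i j, |(covMatrix v Q' i j + mean v Q' i * mean v Q' j) - secondMoment v Q i j| ≤ ε :=
    fun i j => by
      rw [← secondMoment_eq_covMatrix_add hQ'.2]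
      exact (h2 i j).trans (by linarith [hε i])
  refine ⟨covMatrix_posSemidef hQ'.1, h1', h2', fun R hR hv i j => ?_, fun hF => ?_⟩
  · have hmean : ∀ (Q : X → ℝ), IsDistribution Q → ∀ i, |mean v Q i| ≤ R := fun Q hQ i => by
      rw [mean, ← one_mul R, ← hQ.2, Finset.sum_mul]
      refine (Finset.abs_sum_le_sum_abs _ _).trans (Finset.sum_le_sum fun x _ => ?_)
      rw [abs_mul, abs_of_nonneg (hQ.1 x)]
      exact mul_le_mul_of_nonneg_left (hv x i) (hQ.1 x)
    have e : covMatrix v Q' i j - covMatrix v Q i j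
        = (secondMoment v Q' i j - secondMoment v Q i j)
          - mean v Q' i * (mean v Q' j - mean v Q j)
          - mean v Q j * (mean v Q' i - mean v Q i) := by
      rw [secondMoment_eq_covMatrix_add hQ'.2, secondMoment_eq_covMatrix_add hQ.2]; ring
    have a1 : |mean v Q' i * (mean v Q' j - mean v Q j)| ≤ R * (ε / 3) := by
      rw [abs_mul]; exact mul_le_mul (hmean Q' hQ' i) (h1 j) (abs_nonneg _) (by linarith)
    have a2 : |mean v Q j * (mean v Q' i - mean v Q i)| ≤ R * (ε / 3) := by
      rw [abs_mul]; exact mul_le_mul (hmean Q hQ j) (h1 i) (abs_nonneg _) (by linarith)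
    have a3 : ε / 3 ≤ R * (ε / 3) := le_mul_of_one_le_left (by linarith [hε i]) hR
    rw [e]
    have b1 := abs_sub (secondMoment v Q' i j - secondMoment v Q i j
      - mean v Q' i * (mean v Q' j - mean v Q j)) (mean v Q j * (mean v Q' i - mean v Q i))
    have b2 := abs_sub (secondMoment v Q' i j - secondMoment v Q i j)
      (mean v Q' i * (mean v Q' j - mean v Q j))
    linarith [h2 i j]
  · obtain ⟨hprob, hL2, hmean, hcov⟩ := hF
    refine ⟨fun i => ?_, fun i j => ?_⟩
    · rw [hmean i]; exact h1' i
    · have h3 := ProbabilityTheory.covariance_eq_sub (hL2 i) (hL2 j)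
      rw [hcov i j, hmean i, hmean j] at h3
      have h4 : ∫ y, y i * y j ∂(F (mean v Q') (covMatrix v Q'))
          = covMatrix v Q' i j + mean v Q' i * mean v Q' j := by
        rw [eq_sub_iff_add_eq] at h3
        exact h3.symm
      rw [h4]; exact h2' i j

end Moments

section Update

variable {X 𝓔 : Type} [Fintype X] [DecidableEq X] {m L D : ℕ}

/-- The quantities to be estimated: the total weight, the first and the second moments. -/
abbrev Moment (D : ℕ) : Type := Option (Fin D ⊕ Fin D × Fin D)

/-- The functions whose weighted means determine the moments, normalised to `[-1, 1]`. -/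
def momentFun (v : X → Fin D → ℝ) (lam₁ : Fin D → ℝ) (lam₂ : Fin D → Fin D → ℝ) (Δlam : ℝ) :
    Moment D → X → ℝ
  | none, _ => 1
  | some (.inl i), x => (v x i - lam₁ i) / Δlam
  | some (.inr (i, j)), x => (v x i * v x j - lam₂ i j) / Δlam

open Classical in
/-- The mean and covariance of some distribution whose moments are within `ε / 6` of the estimates
computed from `r`. Its covariance matrix is automatically positive semidefinite. The value `0`
stands for inconsistent estimates. -/
def modelOf (v : X → Fin D → ℝ) (lam₁ : Fin D → ℝ) (lam₂ : Fin D → Fin D → ℝ) (Δlam ε : ℝ)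
    (r : Moment D → ℝ) : (Fin D → ℝ) × Matrix (Fin D) (Fin D) ℝ :=
  if h : ∃ Q : X → ℝ, IsDistribution Q ∧
      (∀ i, |mean v Q i - (lam₁ i + Δlam * (r (some (.inl i)) / r none))| ≤ ε / 6) ∧
      ∀ i j, |secondMoment v Q i j - (lam₂ i j + Δlam * (r (some (.inr (i, j))) / r none))| ≤ ε / 6
  then (mean v h.choose, covMatrix v h.choose) else 0

variable {Out : Type} {σ : Setting X 𝓔 m (Work L m) Out} {x₀ : X} {decode : Bits m → ℝ}
  {Γ : 𝓔 → ℝ} {P : X → ℝ} {E : Fin L → 𝓔}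

lemma weighted_one {X 𝓔 : Type} [Fintype X] {m L : ℕ}
    (decode : Bits m → ℝ) (bits : 𝓔 → X → Bits m) (Γ : 𝓔 → ℝ) (E : Fin L → 𝓔) (P : X → ℝ) :
    weighted decode bits Γ E P (fun _ => 1)
      = overlap P (likelihood decode bits) Γ E := by
  simp [weighted, overlap, pairing, relLik]

/-- The bounds `Γ` cancel in the posterior. -/
lemma posterior_eq {X 𝓔 : Type} [Fintype X] {m L : ℕ} {decode : Bits m → ℝ} {Γ : 𝓔 → ℝ}
    {P : X → ℝ} {E : Fin L → 𝓔} (bits : 𝓔 → X → Bits m)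
    (hp : 0 < overlap P (likelihood decode bits) Γ E) (x : X) :
    posterior P (likelihood decode bits) E x
      = P x * relLik decode bits Γ E x / overlap P (likelihood decode bits) Γ E := by
  have hrel : ∀ x, relLik decode bits Γ E x
      = (∏ k, likelihood decode bits (E k) x) / ∏ k, Γ (E k) := fun x => Finset.prod_div_distrib _ _
  have hov : overlap P (likelihood decode bits) Γ E
      = pairing (fun x => ∏ k, likelihood decode bits (E k) x) P / ∏ k, Γ (E k) := by
    rw [← weighted_one, weighted, pairing, Finset.sum_div]
    refine Finset.sum_congr rfl fun x _ => ?_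
    rw [hrel]; ring
  have hΓ : ∏ k, Γ (E k) ≠ 0 := by
    intro h; rw [hov, h, div_zero] at hp; exact lt_irrefl _ hp
  rw [hov, hrel, posterior, bayes, ← mul_div_assoc, div_div_div_cancel_right₀ hΓ, mul_comm]

lemma posterior_isDistribution (hσ : Admissible σ x₀ decode Γ P)
    (hp : 0 < overlap P (likelihood decode σ.bits) Γ E) :
    IsDistribution (posterior P (likelihood decode σ.bits) E) := by
  refine ⟨fun x => ?_, ?_⟩
  · rw [posterior_eq σ.bits hp]
    exact div_nonneg (mul_nonneg (hσ.dist.1 x) (relLik_mem hσ x).1) hp.le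
  · simp only [posterior_eq σ.bits hp]
    rw [← Finset.sum_div, div_eq_one_iff_eq hp.ne', ← weighted_one, weighted]
    simp

/-- A posterior mean is a ratio of weighted sums. -/
lemma sum_posterior_mul {X 𝓔 : Type} [Fintype X] {m L : ℕ} {decode : Bits m → ℝ} {Γ : 𝓔 → ℝ}
    {P : X → ℝ} {E : Fin L → 𝓔} (bits : 𝓔 → X → Bits m)
    (hp : 0 < overlap P (likelihood decode bits) Γ E) (f : X → ℝ) :
    ∑ x, posterior P (likelihood decode bits) E x * f x
      = weighted decode bits Γ E P f / overlap P (likelihood decode bits) Γ E := by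
  rw [weighted, Finset.sum_div]
  refine Finset.sum_congr rfl fun x _ => ?_
  rw [posterior_eq bits hp]; ring

lemma abs_momentFun_le {X : Type} {D : ℕ} {v : X → Fin D → ℝ} {lam₁ : Fin D → ℝ}
    {lam₂ : Fin D → Fin D → ℝ} {Δlam : ℝ} (hΔ : 0 < Δlam) (h1 : ∀ x i, |v x i - lam₁ i| ≤ Δlam)
    (h2 : ∀ x i j, |v x i * v x j - lam₂ i j| ≤ Δlam) (i : Moment D) (x : X) :
    |momentFun v lam₁ lam₂ Δlam i x| ≤ 1 := by
  rcases i with _ | i | ⟨i, j⟩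
  · simp [momentFun]
  · rw [momentFun, abs_div, abs_of_pos hΔ]; exact div_le_one_of_le₀ (h1 x i) hΔ.le
  · rw [momentFun, abs_div, abs_of_pos hΔ]; exact div_le_one_of_le₀ (h2 x i j) hΔ.le

lemma abs_div_sub_div_le {a b a' b' δ : ℝ} (hb : 0 < b) (hb' : 0 < b') (hab : |a| ≤ b)
    (h1 : |a' - a| ≤ δ) (h2 : |b' - b| ≤ δ) : |a' / b' - a / b| ≤ 2 * δ / b' := by
  have e : a' / b' - a / b = ((a' - a) - (a / b) * (b' - b)) / b' := by field_simp; ring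
  have h3 : |a / b| ≤ 1 := by rw [abs_div, abs_of_pos hb]; exact div_le_one_of_le₀ hab hb.le
  have h4 : |(a / b) * (b' - b)| ≤ δ := by
    rw [abs_mul]; nlinarith [abs_nonneg (b' - b), abs_nonneg (a / b)]
  rw [e, abs_div, abs_of_pos hb']
  gcongr
  linarith [abs_sub (a' - a) ((a / b) * (b' - b))]

lemma abs_weighted_le (hσ : Admissible σ x₀ decode Γ P) {f : X → ℝ} (hf : ∀ x, |f x| ≤ 1) :
    |weighted decode σ.bits Γ E P f| ≤ overlap P (likelihood decode σ.bits) Γ E := by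
  rw [← weighted_one, weighted, weighted]
  refine (Finset.abs_sum_le_sum_abs _ _).trans (Finset.sum_le_sum fun x _ => ?_)
  have h1 := (relLik_mem (E := E) hσ x).1
  rw [abs_mul, abs_mul, abs_of_nonneg h1, abs_of_nonneg (hσ.dist.1 x)]
  exact mul_le_mul_of_nonneg_left (mul_le_mul_of_nonneg_right (hf x) h1) (hσ.dist.1 x)

/-- Estimates within `δ` give a valid model as soon as the estimated weight is at least
`12 δ Δλ / ε`. -/
lemma isSemiClassicalModel_modelOf (hσ : Admissible σ x₀ decode Γ P)
    (F : (Fin D → ℝ) → Matrix (Fin D) (Fin D) ℝ → MeasureTheory.Measure (Fin D → ℝ))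
    {v : X → Fin D → ℝ} {lam₁ : Fin D → ℝ} {lam₂ : Fin D → Fin D → ℝ} {Δlam ε δ : ℝ}
    (hΔ : 0 < Δlam) (h1 : ∀ x i, |v x i - lam₁ i| ≤ Δlam)
    (h2 : ∀ x i j, |v x i * v x j - lam₂ i j| ≤ Δlam) (hε : 0 < ε) (hδ : 0 < δ)
    (hp : 0 < overlap P (likelihood decode σ.bits) Γ E) {r : Moment D → ℝ}
    (hr : ∀ i, |r i - weighted decode σ.bits Γ E P (momentFun v lam₁ lam₂ Δlam i)| ≤ δ)
    (hlarge : 12 * δ * Δlam / ε ≤ r none) :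
    IsSemiClassicalModel F v (posterior P (likelihood decode σ.bits) E) ε
      (modelOf v lam₁ lam₂ Δlam ε r) := by
  set Q := posterior P (likelihood decode σ.bits) E with hQdef
  have hQ : IsDistribution Q := posterior_isDistribution hσ hp
  have hr0 : 0 < r none := lt_of_lt_of_le (by positivity) hlarge
  have hnone : |r none - overlap P (likelihood decode σ.bits) Γ E| ≤ δ := by
    rw [← weighted_one]; exact hr none
  -- A weighted mean of a normalised function is estimated to within `ε / 6` after rescaling.
  have key : ∀ (i : Moment D) (g : X → ℝ) (lam : ℝ),
      (∀ x, g x = lam + Δlam * momentFun v lam₁ lam₂ Δlam i x) →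
      |∑ x, Q x * g x - (lam + Δlam * (r i / r none))| ≤ ε / 6 := fun i g lam hg => by
    have e : ∑ x, Q x * g x = lam + Δlam * (weighted decode σ.bits Γ E P
        (momentFun v lam₁ lam₂ Δlam i) / overlap P (likelihood decode σ.bits) Γ E) := by
      rw [← sum_posterior_mul σ.bits hp, ← hQdef]
      simp only [hg, mul_add, Finset.sum_add_distrib, ← Finset.sum_mul, hQ.2, one_mul,
        Finset.mul_sum]
      congr 1
      exact Finset.sum_congr rfl fun x _ => by ring
    rw [e, add_sub_add_left_eq_sub, ← mul_sub, abs_mul, abs_of_pos hΔ, abs_sub_comm]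
    have h3 := abs_div_sub_div_le hp hr0
      (abs_weighted_le hσ (abs_momentFun_le hΔ h1 h2 i)) (hr i) hnone
    calc Δlam * _ ≤ Δlam * (2 * δ / r none) := mul_le_mul_of_nonneg_left h3 hΔ.le
      _ = (2 * δ * Δlam) / r none := by ring
      _ ≤ ε / 6 := by
        rw [div_le_iff₀ hε] at hlarge
        rw [div_le_div_iff₀ hr0 (by norm_num)]
        linarith
  have k1 : ∀ i, |mean v Q i - (lam₁ i + Δlam * (r (some (.inl i)) / r none))| ≤ ε / 6 :=
    fun i => key _ _ _ fun x => by rw [momentFun]; field_simp; ring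
  have k2 : ∀ i j, |secondMoment v Q i j
      - (lam₂ i j + Δlam * (r (some (.inr (i, j))) / r none))| ≤ ε / 6 :=
    fun i j => key _ _ _ fun x => by rw [momentFun]; field_simp; ring
  have hex : ∃ Q : X → ℝ, IsDistribution Q ∧
      (∀ i, |mean v Q i - (lam₁ i + Δlam * (r (some (.inl i)) / r none))| ≤ ε / 6) ∧
      ∀ i j, |secondMoment v Q i j - (lam₂ i j + Δlam * (r (some (.inr (i, j))) / r none))|
        ≤ ε / 6 := ⟨Q, hQ, k1, k2⟩
  obtain ⟨c1, c2, c3⟩ := hex.choose_spec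
  rw [modelOf, dif_pos hex]
  refine isSemiClassicalModel_of_close F hQ c1 (fun i => ?_) fun i j => ?_
  · have a := abs_sub_le (mean v hex.choose i) (lam₁ i + Δlam * (r (some (.inl i)) / r none))
      (mean v Q i)
    have b := k1 i
    rw [abs_sub_comm] at b
    linarith [c2 i]
  · have a := abs_sub_le (secondMoment v hex.choose i j)
      (lam₂ i j + Δlam * (r (some (.inr (i, j))) / r none)) (secondMoment v Q i j)
    have b := k2 i j
    rw [abs_sub_comm] at b
    linarith [c3 i j]

end Update

/-! ### The update algorithm and its cost -/

section Loop

variable {X 𝓔 : Type} [Fintype X] [DecidableEq X] {m L D : ℕ}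

/-- The number of samples taken per moment in stage `k`: logarithmic in the number of moments and
the failure probability, with a term linear in `k` that pays for the grid of size `2 ^ k` and makes
the failure probabilities summable. -/
def sampleCount (D : ℕ) (η : ℝ) (k : ℕ) : ℕ :=
  ⌈1024 * (Real.log (2 / η) + Real.log (Fintype.card (Moment D)) + 2 * k + 6)⌉₊

lemma sampleCount_mono (D : ℕ) (η : ℝ) : Monotone (sampleCount D η) := fun j k hjk => by
  have : (j : ℝ) ≤ k := by exact_mod_cast hjk
  exact Nat.ceil_mono (by linarith)

/-- Stage `k` fails with probability at most `η / 2 ^ (k + 1)`. -/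
lemma stage_failure_le (D : ℕ) {η : ℝ} (hη : 0 < η) (k : ℕ) :
    Fintype.card (Moment D) * (192 * 2 ^ k * Real.exp (-(sampleCount D η k : ℝ) / 1024))
      ≤ η / 2 ^ (k + 1) := by
  set c : ℝ := ((Fintype.card (Moment D) : ℕ) : ℝ) with hc
  have hc0 : 0 < c := by rw [hc]; exact_mod_cast Fintype.card_pos
  have h1 : 1024 * (Real.log (2 / η) + Real.log c + 2 * k + 6) ≤ sampleCount D η k :=
    Nat.le_ceil _
  have h2 : Real.exp (-(sampleCount D η k : ℝ) / 1024)
      ≤ Real.exp (-Real.log (2 / η) + -Real.log c + -((2 * k + 6 : ℕ) : ℝ)) :=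
    Real.exp_le_exp.2 (by push_cast; linarith)
  rw [Real.exp_add, Real.exp_add, Real.exp_neg, Real.exp_neg, Real.exp_log (by positivity),
    Real.exp_log hc0, Real.exp_neg] at h2
  have h3 : (192 : ℝ) * 4 ^ k ≤ Real.exp ((2 * k + 6 : ℕ) : ℝ) := by
    have he : (2.7 : ℝ) ≤ Real.exp 1 := by linarith [Real.exp_one_gt_d9]
    have h4 : Real.exp ((2 * k + 6 : ℕ) : ℝ) = (Real.exp 1 ^ 2) ^ k * Real.exp 1 ^ 6 := by
      rw [← pow_mul, ← pow_add, ← Real.exp_nat_mul, mul_one]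
    have h5 : (4 : ℝ) ≤ Real.exp 1 ^ 2 := by nlinarith
    have h6 : (192 : ℝ) ≤ Real.exp 1 ^ 6 :=
      le_trans (by norm_num) (pow_le_pow_left₀ (by norm_num) he 6)
    rw [h4, mul_comm]
    exact mul_le_mul (pow_le_pow_left₀ (by norm_num) h5 k) h6 (by norm_num) (by positivity)
  calc c * (192 * 2 ^ k * Real.exp (-(sampleCount D η k : ℝ) / 1024))
      ≤ c * (192 * 2 ^ k * ((2 / η)⁻¹ * c⁻¹ * (Real.exp ((2 * k + 6 : ℕ) : ℝ))⁻¹)) := by gcongr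
    _ = 192 * 2 ^ k * (η / 2) * (Real.exp ((2 * k + 6 : ℕ) : ℝ))⁻¹ := by
        rw [inv_div]; field_simp
    _ ≤ 192 * 2 ^ k * (η / 2) * (192 * 4 ^ k)⁻¹ := by gcongr
    _ = η / 2 ^ (k + 1) := by
        rw [show (4 : ℝ) ^ k = 2 ^ k * 2 ^ k by rw [← mul_pow]; norm_num, pow_succ]
        field_simp

open Classical in
/-- Stage `k` of the update: estimate all moments to within `4 / 2 ^ k`; stop if the estimated
weight of the evidence is large enough for this accuracy, and otherwise go on to the next stage. -/
def stageProg (x₀ : X) (v : X → Fin D → ℝ) (decode : Bits m → ℝ) (E : Fin L → 𝓔) (Γ : 𝓔 → ℝ)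
    (lam₁ : Fin D → ℝ) (lam₂ : Fin D → Fin D → ℝ) (Δlam ε η : ℝ) (k : ℕ) :
    Prog X 𝓔 m (Work L m) ((Fin D → ℝ) × Matrix (Fin D) (Fin D) ℝ) :=
  estimatesProg decode Γ E x₀ k (sampleCount D η k) (momentFun v lam₁ lam₂ Δlam)
    Finset.univ.toList 0 fun r =>
      if 12 * (4 / 2 ^ k) * Δlam / ε ≤ r none then .halt (modelOf v lam₁ lam₂ Δlam ε r)
      else .jump (k + 1)

lemma normSq_basisKet {W : Type} [Fintype W] [DecidableEq W] (z : Config X m W) :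
    normSq (basisKet z) = 1 := by
  rw [normSq, Finset.sum_eq_single z]
  · simp [basisKet]
  · intro z' _ h; simp [basisKet, h]
  · simp

variable {σ : Setting X 𝓔 m (Work L m) ((Fin D → ℝ) × Matrix (Fin D) (Fin D) ℝ)} {x₀ : X}
  {decode : Bits m → ℝ} {Γ : 𝓔 → ℝ} {P : X → ℝ} {E : Fin L → 𝓔} {v : X → Fin D → ℝ}
  {lam₁ : Fin D → ℝ} {lam₂ : Fin D → Fin D → ℝ} {Δlam ε η : ℝ}

/-- Once stage `K` is certain to stop, the stages `k, …, K` together succeed with probability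
`1 - η / 2 ^ k`. -/
lemma achieves_stages (hσ : Admissible σ x₀ decode Γ P)
    (hbody : σ.body = stageProg x₀ v decode E Γ lam₁ lam₂ Δlam ε η)
    (hη : 0 < η) (hf : ∀ i x, |momentFun v lam₁ lam₂ Δlam i x| ≤ 1)
    (hgood : ∀ (k : ℕ) (r : Moment D → ℝ),
      (∀ i, |r i - weighted decode σ.bits Γ E P (momentFun v lam₁ lam₂ Δlam i)| ≤ 4 / 2 ^ k) →
      12 * (4 / 2 ^ k) * Δlam / ε ≤ r none → σ.good (modelOf v lam₁ lam₂ Δlam ε r))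
    {K : ℕ} (hK : ∀ y : ℝ, |y - overlap P (likelihood decode σ.bits) Γ E| ≤ 4 / 2 ^ K →
      12 * (4 / 2 ^ K) * Δlam / ε ≤ y) (d k : ℕ) (hk : k + d = K) :
    Achieves σ (.jump k) (basisKet (x₀, blank m L))
      (∑ j ∈ Finset.Ico k (K + 1),
        Fintype.card (Moment D) * (sampleCount D η K * (2 ^ (j + 5) * L)))
      (1 - η / 2 ^ k) := by
  classical
  have hhalt : ∀ (k q : ℕ) (r : Moment D → ℝ) (s : Prog X 𝓔 m (Work L m) _),
      (∀ i, |r i - weighted decode σ.bits Γ E P (momentFun v lam₁ lam₂ Δlam i)| ≤ 4 / 2 ^ k) →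
      12 * (4 / 2 ^ k) * Δlam / ε ≤ r none →
      Achieves σ (if 12 * (4 / 2 ^ k) * Δlam / ε ≤ r none
        then .halt (modelOf v lam₁ lam₂ Δlam ε r) else s) (basisKet (x₀, blank m L)) q 1 :=
    fun k q r s hr hlarge => by
      rw [if_pos hlarge]
      exact (achieves_halt (hgood k r hr hlarge) _).weaken (Nat.zero_le q)
        (by rw [normSq_basisKet])
  have hstage : ∀ (k q : ℕ), k ≤ K → (∀ r : Moment D → ℝ,
      (∀ i, |r i - weighted decode σ.bits Γ E P (momentFun v lam₁ lam₂ Δlam i)| ≤ 4 / 2 ^ k) →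
      Achieves σ (if 12 * (4 / 2 ^ k) * Δlam / ε ≤ r none
        then .halt (modelOf v lam₁ lam₂ Δlam ε r) else .jump (k + 1)) (basisKet (x₀, blank m L)) q
        (1 - η / 2 ^ (k + 1))) →
      Achieves σ (.jump k) (basisKet (x₀, blank m L))
        (q + Fintype.card (Moment D) * (sampleCount D η K * (2 ^ (k + 5) * L)))
        (1 - η / 2 ^ k) := fun k q hkK h => by
    have hpos : 0 < η / 2 ^ (k + 1) := by positivity
    have h1 := achieves_estimatesProg (E := E) hσ k (sampleCount D η k) hf (by linarith) h
      Finset.univ.toList 0 fun i => Or.inl (by simp)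
    refine achieves_jump ?_
    rw [hbody]
    refine h1.weaken ?_ ?_
    · rw [Finset.length_toList, Finset.card_univ]
      gcongr
      exact sampleCount_mono D η hkK
    · rw [Finset.length_toList, Finset.card_univ]
      have h2 := stage_failure_le D hη k
      have h3 : η / 2 ^ k = η / 2 ^ (k + 1) + η / 2 ^ (k + 1) := by rw [pow_succ]; field_simp; ring
      linarith
  induction d generalizing k with
  | zero =>
    obtain rfl : k = K := by omega
    rw [Nat.Ico_succ_singleton, Finset.sum_singleton, ← Nat.zero_add (Fintype.card _ * _)]
    refine hstage k 0 le_rfl fun r hr => (hhalt k 0 r _ hr (hK _ ?_)).weaken le_rfl ?_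
    · rw [← weighted_one]; exact hr none
    · have : 0 < η / 2 ^ (k + 1) := by positivity
      linarith
  | succ d ih =>
    rw [Finset.sum_eq_sum_Ico_succ_bot (by omega), add_comm]
    refine hstage k _ (by omega) fun r hr => ?_
    by_cases hlarge : 12 * (4 / 2 ^ k) * Δlam / ε ≤ r none
    · refine (hhalt k _ r _ hr hlarge).weaken le_rfl ?_
      have : 0 < η / 2 ^ (k + 1) := by positivity
      linarith
    · rw [if_neg hlarge]
      exact ih (k + 1) (by omega)

end Loop

/-- The number of samples is logarithmic in the leading term `T` of the query count. -/
lemma sampleCount_le {D K : ℕ} {η T y : ℝ} (hη : 0 < η) (hη1 : η < 1) (hD : (1 : ℝ) ≤ D)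
    (hDT : (D : ℝ) ^ 2 / 6 ≤ T) (hyT : y ≤ T) (hK : (2 : ℝ) ^ K ≤ 144 * y) :
    (sampleCount D η K : ℝ) ≤ 120000 * (Real.log (2 + T) * Real.log (2 / η)) := by
  set a := Real.log (2 / η)
  set b := Real.log (2 + T) with hb
  have hT : 0 ≤ T := le_trans (by positivity) hDT
  have hl2 : 1 / 2 ≤ Real.log 2 := by linarith [Real.log_two_gt_d9]
  have ha : 1 / 2 ≤ a := hl2.trans (Real.log_le_log (by norm_num) (by
    rw [le_div_iff₀ hη]; linarith))
  have hb2 : Real.log 2 ≤ b := Real.log_le_log (by norm_num) (by linarith)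
  have hpow : ∀ (n : ℕ) (x : ℝ), 0 < x → x ≤ 2 ^ n * (2 + T) → Real.log x ≤ (n + 1) * b := by
    intro n x hx hxT
    have := Real.log_le_log hx hxT
    rw [Real.log_mul (by positivity) (by positivity), Real.log_pow] at this
    have hn : (n : ℝ) * Real.log 2 ≤ n * b := by gcongr
    linarith
  have hcard : (Fintype.card (Moment D) : ℝ) ≤ 3 * (D : ℝ) ^ 2 := by
    simp only [Fintype.card_option, Fintype.card_sum, Fintype.card_prod, Fintype.card_fin]
    push_cast; nlinarith
  have hc := hpow 5 (Fintype.card (Moment D)) (by exact_mod_cast Fintype.card_pos) (by linarith)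
  have hK2 := hpow 8 (2 ^ K) (by positivity) (by linarith)
  rw [Real.log_pow] at hK2
  have hK3 : (K : ℝ) ≤ 18 * b := by
    have hK0 : (0 : ℝ) ≤ K := Nat.cast_nonneg K
    push_cast at hK2
    nlinarith
  have hb0 : 1 / 2 ≤ b := hl2.trans hb2
  have hceil := (Nat.ceil_lt_add_one (a := 1024 * (a + Real.log (Fintype.card (Moment D))
    + 2 * K + 6)) (by
      have : 0 ≤ Real.log (Fintype.card (Moment D)) := Real.log_natCast_nonneg _
      have hK0 : (0 : ℝ) ≤ K := Nat.cast_nonneg K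
      linarith)).le
  push_cast at hc
  have h1 : (sampleCount D η K : ℝ) ≤ 1024 * (a + 54 * b) + 1 := hceil.trans (by linarith)
  nlinarith

/-- The total number of queries is within the soft-O bound. -/
lemma queries_le_softBound {L D K : ℕ} {Δlam ε η p : ℝ} (hη : 0 < η) (hη1 : η < 1) (hD : 1 ≤ D)
    (hε : 0 < ε) (hΔ : ε / 6 < Δlam) (hp : 0 < p) (hp1 : p ≤ 1)
    (hK : (2 : ℝ) ^ K ≤ 144 * (Δlam / (ε * p))) :
    ((∑ j ∈ Finset.Ico 0 (K + 1),
      Fintype.card (Moment D) * (sampleCount D η K * (2 ^ (j + 5) * L)) : ℕ) : ℝ)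
      ≤ softBound 4000000000 1 (leadingCost L D Δlam ε p) η := by
  rcases Nat.eq_zero_or_pos L with rfl | hL
  · simp [softBound, leadingCost]
  have hD' : (1 : ℝ) ≤ D := by exact_mod_cast hD
  have hL' : (1 : ℝ) ≤ L := by exact_mod_cast hL
  set y := Δlam / (ε * p) with hy
  have hy6 : 1 / 6 ≤ y := by
    rw [hy, le_div_iff₀ (by positivity)]; nlinarith
  set T := leadingCost L D Δlam ε p with hTdef
  have hT : T = L * (D : ℝ) ^ 2 * y := by rw [hTdef, leadingCost, hy, mul_div_assoc]
  have hD2 : (1 : ℝ) ≤ (D : ℝ) ^ 2 := one_le_pow₀ hD'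
  have hLD : (D : ℝ) ^ 2 ≤ L * (D : ℝ) ^ 2 := le_mul_of_one_le_left (by positivity) hL'
  have hn := sampleCount_le (T := T) hη hη1 hD' (by rw [hT]; nlinarith)
    (by rw [hT]; exact le_mul_of_one_le_left (by linarith) (hD2.trans hLD)) hK
  set ab := Real.log (2 + T) * Real.log (2 / η) with hab
  have hab0 : 0 ≤ ab := by
    have : (0 : ℝ) ≤ sampleCount D η K := Nat.cast_nonneg _
    linarith
  have hgeom : ∑ j ∈ Finset.Ico 0 (K + 1), 2 ^ (j + 5) ≤ 64 * 2 ^ K := by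
    have h := Nat.geomSum_lt (m := 2) (n := K + 1) (s := Finset.range (K + 1)) le_rfl (by simp)
    have e : ∑ j ∈ Finset.Ico 0 (K + 1), 2 ^ (j + 5)
        = (∑ j ∈ Finset.range (K + 1), 2 ^ j) * 32 := by
      rw [Nat.Ico_zero_eq_range, Finset.sum_mul]
      exact Finset.sum_congr rfl fun j _ => by rw [pow_add]; norm_num
    rw [pow_succ] at h
    omega
  have hsum : ∑ j ∈ Finset.Ico 0 (K + 1),
      Fintype.card (Moment D) * (sampleCount D η K * (2 ^ (j + 5) * L))
      ≤ Fintype.card (Moment D) * (sampleCount D η K * (64 * 2 ^ K * L)) := by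
    rw [← Finset.mul_sum, ← Finset.mul_sum, ← Finset.sum_mul]
    gcongr
  have hcard : (Fintype.card (Moment D) : ℝ) ≤ 3 * (D : ℝ) ^ 2 := by
    simp only [Fintype.card_option, Fintype.card_sum, Fintype.card_prod, Fintype.card_fin]
    push_cast; nlinarith
  calc ((∑ j ∈ Finset.Ico 0 (K + 1),
      Fintype.card (Moment D) * (sampleCount D η K * (2 ^ (j + 5) * L)) : ℕ) : ℝ)
      ≤ Fintype.card (Moment D) * (sampleCount D η K * (64 * 2 ^ K * L)) := by exact_mod_cast hsum
    _ ≤ (3 * (D : ℝ) ^ 2) * ((120000 * ab) * (64 * (144 * y) * L)) := by gcongr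
    _ = (3 * 120000 * 64 * 144) * (T * ab) := by rw [hT]; ring
    _ ≤ 4000000000 * (T * ab) := by
        have : 0 ≤ T * ab := mul_nonneg (by rw [hT]; positivity) hab0
        exact mul_le_mul_of_nonneg_right (by norm_num) this
    _ = _ := by rw [softBound, pow_one, hab]; ring

lemma softBound_nonneg {C T η : ℝ} {c : ℕ} (hC : 0 ≤ C) (hT : 0 ≤ T) (hη : 0 < η) (hη1 : η < 1) :
    0 ≤ softBound C c T η := by
  have h1 : 0 ≤ Real.log (2 + T) := Real.log_nonneg (by linarith)
  have h2 : 0 ≤ Real.log (2 / η) := Real.log_nonneg (by rw [le_div_iff₀ hη]; linarith)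
  rw [softBound]; positivity

lemma abs_sum_mul_sub_le {X : Type} [Fintype X] {Q g : X → ℝ} {c δ : ℝ} (hQ : IsDistribution Q)
    (hg : ∀ x, |g x - c| ≤ δ) : |∑ x, Q x * g x - c| ≤ δ := by
  have e : ∑ x, Q x * g x - c = ∑ x, Q x * (g x - c) := by
    simp only [mul_sub, Finset.sum_sub_distrib, ← Finset.sum_mul, hQ.2, one_mul]
  rw [e, ← one_mul δ, ← hQ.2, Finset.sum_mul]
  refine (Finset.abs_sum_le_sum_abs _ _).trans (Finset.sum_le_sum fun x _ => ?_)
  rw [abs_mul, abs_of_nonneg (hQ.1 x)]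
  exact mul_le_mul_of_nonneg_left (hg x) (hQ.1 x)

end SemiClassicalBayes

end

theorem mainTheorem2 :
    ∃ (C : ℝ) (c : ℕ), 0 < C ∧
      -- known data: hypotheses `v x ∈ ℝ^D`, number encoding, evidence, bounds, accuracy
      ∀ (X 𝓔 : Type) [Fintype X] [DecidableEq X] (x₀ : X)
        (D L m : ℕ) (v : X → Fin D → ℝ) (decode : SemiClassicalBayes.Bits m → ℝ)
        (E : Fin L → 𝓔) (Γ : 𝓔 → ℝ)
        (lam₁ : Fin D → ℝ) (lam₂ : Fin D → Fin D → ℝ) (Δlam ε η : ℝ),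
        (∀ e, Γ e ≤ 1) →
        (∀ x i, |v x i - lam₁ i| ≤ Δlam) →
        (∀ x i j, |v x i * v x j - lam₂ i j| ≤ Δlam) →
        0 < ε → 0 < η → η < 1 →
        ∃ (W S : Type) (_ : Fintype W) (_ : DecidableEq W)
          (A : SemiClassicalBayes.Algorithm X 𝓔 m W S
            ((Fin D → ℝ) × Matrix (Fin D) (Fin D) ℝ)),
          -- black boxes: the preparation `U` of the prior state, and the likelihood oracles
          ∀ (P : X → ℝ) (U : Matrix X X ℂ) (bits : 𝓔 → X → SemiClassicalBayes.Bits m)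
            (F : (Fin D → ℝ) → Matrix (Fin D) (Fin D) ℝ → MeasureTheory.Measure (Fin D → ℝ)),
            SemiClassicalBayes.IsDistribution P →
            U ∈ Matrix.unitaryGroup X ℂ →
            (∀ x, U x x₀ = (Real.sqrt (P x) : ℂ)) →
            (∀ e x, 0 ≤ SemiClassicalBayes.likelihood decode bits e x ∧
              SemiClassicalBayes.likelihood decode bits e x ≤ Γ e) →
            0 < SemiClassicalBayes.overlap P (SemiClassicalBayes.likelihood decode bits) Γ E →
            ∃ q : ℕ,
              (q : ℝ) ≤ SemiClassicalBayes.softBound C c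
                (SemiClassicalBayes.leadingCost L D Δlam ε
                  (SemiClassicalBayes.overlap P (SemiClassicalBayes.likelihood decode bits) Γ E))
                η ∧
              SemiClassicalBayes.SucceedsWithin A U bits
                (SemiClassicalBayes.IsSemiClassicalModel F v
                  (SemiClassicalBayes.posterior P (SemiClassicalBayes.likelihood decode bits) E) ε)
                q (1 - η) := by
  classical
  open SemiClassicalBayes in
  refine ⟨4000000000, 1, by norm_num, ?_⟩
  intro X 𝓔 _ _ x₀ D L m v decode E Γ lam₁ lam₂ Δlam ε η _ h1 h2 hε hη hη1
  by_cases htriv : D = 0 ∨ Δlam ≤ ε / 6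
  · -- The error of the prior guess is already small: output a point mass without any query.
    set Q' : X → ℝ := Pi.single x₀ 1 with hQ'def
    have hQ' : IsDistribution Q' := ⟨fun x => by
      rw [hQ'def, Pi.single_apply]; split_ifs <;> norm_num, by simp [hQ'def]⟩
    refine ⟨Work L m, _, inferInstance, inferInstance,
      Prog.toAlgorithm (x₀, blank m L) fun _ => .halt (mean v Q', covMatrix v Q'), ?_⟩
    intro P U bits F hP hU hprior hlik hp
    let σ : Setting X 𝓔 m (Work L m) ((Fin D → ℝ) × Matrix (Fin D) (Fin D) ℝ) :=
      ⟨(x₀, blank m L), fun _ => .halt (mean v Q', covMatrix v Q'), U, bits,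
        IsSemiClassicalModel F v (posterior P (likelihood decode bits) E) ε⟩
    have hσ : Admissible σ x₀ decode Γ P := ⟨hP, hU, hprior, hlik⟩
    have hQ := posterior_isDistribution (E := E) hσ hp
    have hT : 0 ≤ leadingCost L D Δlam ε (overlap P (likelihood decode bits) Γ E) := by
      rcases Nat.eq_zero_or_pos D with rfl | hD
      · simp [leadingCost]
      · have : 0 ≤ Δlam := (abs_nonneg _).trans (h1 x₀ ⟨0, hD⟩)
        rw [leadingCost]; positivity
    have hΔ : ∀ _ : Fin D, Δlam ≤ ε / 6 := fun i => htriv.resolve_left (by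
      rintro rfl; exact i.elim0)
    refine ⟨0, by simpa using softBound_nonneg (by norm_num) hT hη hη1, ?_⟩
    have hgood : σ.good (mean v Q', covMatrix v Q') := by
      refine isSemiClassicalModel_of_close F hQ hQ' (fun i => ?_) fun i j => ?_
      · have a := abs_le.1 (abs_sum_mul_sub_le hQ' fun x => h1 x i)
        have b := abs_le.1 (abs_sum_mul_sub_le hQ fun x => h1 x i)
        rw [abs_le, mean, mean]; constructor <;> linarith [hΔ i]
      · have a := abs_le.1 (abs_sum_mul_sub_le hQ' fun x => h2 x i j)
        have b := abs_le.1 (abs_sum_mul_sub_le hQ fun x => h2 x i j)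
        rw [abs_le, secondMoment, secondMoment]; constructor <;> linarith [hΔ i]
    have h : Achieves σ (.jump 0) (basisKet (x₀, blank m L)) 0 (1 - η) :=
      (achieves_jump (achieves_halt hgood _)).weaken le_rfl (by rw [normSq_basisKet]; linarith)
    exact h
  · obtain ⟨hD, hΔ⟩ := not_or.1 htriv
    rw [not_le] at hΔ
    have hΔ0 : 0 < Δlam := lt_trans (by positivity) hΔ
    refine ⟨Work L m, _, inferInstance, inferInstance,
      Prog.toAlgorithm (x₀, blank m L) (stageProg x₀ v decode E Γ lam₁ lam₂ Δlam ε η), ?_⟩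
    intro P U bits F hP hU hprior hlik hp
    let σ : Setting X 𝓔 m (Work L m) ((Fin D → ℝ) × Matrix (Fin D) (Fin D) ℝ) :=
      ⟨(x₀, blank m L), stageProg x₀ v decode E Γ lam₁ lam₂ Δlam ε η, U, bits,
        IsSemiClassicalModel F v (posterior P (likelihood decode bits) E) ε⟩
    have hσ : Admissible σ x₀ decode Γ P := ⟨hP, hU, hprior, hlik⟩
    set p := overlap P (likelihood decode bits) Γ E with hpdef
    have hp1 : p ≤ 1 := by
      rw [hpdef, ← weighted_one, weighted]
      refine (Finset.sum_le_sum fun x _ => mul_le_of_le_one_right (hP.1 x) ?_).trans hP.2.le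
      rw [one_mul]; exact (relLik_mem hσ x).2
    set y := Δlam / (ε * p) with hy
    have hy6 : 1 / 6 ≤ y := by rw [hy, le_div_iff₀ (by positivity)]; nlinarith
    -- The first stage that is certain to stop.
    obtain ⟨K, hK1, hK2⟩ : ∃ K : ℕ, 72 * y ≤ 2 ^ K ∧ (2 : ℝ) ^ K ≤ 144 * y := by
      obtain ⟨n, hn1, hn2⟩ := exists_nat_pow_near (x := 72 * y) (y := 2) (by linarith) (by norm_num)
      exact ⟨n + 1, hn2.le, by rw [pow_succ]; linarith⟩
    refine ⟨_, queries_le_softBound hη hη1 (Nat.one_le_iff_ne_zero.2 hD) hε hΔ hp hp1 hK2, ?_⟩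
    have hlarge : ∀ z : ℝ, |z - overlap P (likelihood decode σ.bits) Γ E| ≤ 4 / 2 ^ K →
        12 * (4 / 2 ^ K) * Δlam / ε ≤ z := by
      intro z hz
      have hz1 := (abs_le.1 hz).1
      have e1 : 72 * (Δlam / ε) / 2 ^ K ≤ p := by
        rw [div_le_iff₀ (by positivity)]
        have : 72 * (Δlam / ε) = p * (72 * y) := by rw [hy]; field_simp
        rw [this]; gcongr
      have e2 : 4 / 2 ^ K ≤ 24 * (Δlam / ε) / 2 ^ K := by
        gcongr
        have : 1 / 6 ≤ Δlam / ε := by rw [le_div_iff₀ hε]; linarith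
        linarith
      have e3 : 12 * (4 / 2 ^ K) * Δlam / ε
          = 72 * (Δlam / ε) / 2 ^ K - 24 * (Δlam / ε) / 2 ^ K := by
        ring
      have e4 : overlap P (likelihood decode σ.bits) Γ E = p := rfl
      rw [e3]; linarith
    have h := achieves_stages (K := K) (v := v) (lam₁ := lam₁) (lam₂ := lam₂) (η := η) hσ rfl hη
      (abs_momentFun_le hΔ0 h1 h2)
      (fun k r hr hr0 => isSemiClassicalModel_modelOf hσ F hΔ0 h1 h2 hε (by positivity) hp hr hr0)
      hlarge K 0 (by omega)
    rw [pow_zero, div_one] at h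
    exact h
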